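/- A pattern of length $k$ is a permutation $\pi=\pi(1)\cdots\pi(k)$ of $\{1,\dots,k\}$, and its complement $\overline\pi$ is the pattern with $\overline\pi(i)=k+1-\pi(i)$. Let $F$ be a finite unordered rooted forest on $n$ vertices (each component has a distinguished root). A downward path with $k$ vertices in $F$ is a sequence of vertices $v_1,\dots,v_k$ such that $v_i$ is the parent of $v_{i+1}$ for all $1\le i<k$. Given a bijective labeling $L$ of the vertices of $F$ by $\{1,\dots,n\}$, such a path is a (consecutive) instance of a pattern $\pi$ of length $k$ if $L(v_1),\dots,L(v_k)$ is in the same relative order as $\pi(1),\dots,\pi(k)$. Two patterns $\pi$ and $\pi'$ of length $k$ are super-strongly c-forest-Wilf equivalent if, for every finite unlabeled rooted forest $F$, with any number $n$ of vertices, and every set $S$ of downward paths with $k$ vertices in $F$, the number of bijective labelings of $F$ by $\{1,\dots,n\}$ for which the set of instances of $\pi$ is exactly $S$ equals the number of those for which the set of instances of $\pi'$ is exactly $S$. **Theorem.** Any super-strong c-forest-Wilf equivalence between two patterns is trivial: if two patterns $\pi$ and $\pi'$ of the same length are super-strongly c-forest-Wilf equivalent, then $\pi'=\pi$ or $\pi'=\overline\pi$.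 -/

import Mathlib

/-- A pattern of length `k`: a permutation of `k` letters. The letters and the positions are
`0, …, k - 1` here instead of `1, …, k`; only their order matters. -/
abbrev Pattern (k : ℕ) := Equiv.Perm (Fin k)

/-- The complement of a pattern: each value `a ∈ {1, …, k}` is replaced by `k + 1 - a`
(with values in `{0, …, k - 1}`, by `k - 1 - a`). -/
def Pattern.complement {k : ℕ} (π : Pattern k) : Pattern k :=
  π.trans Fin.revPerm

/-- An unordered rooted forest with vertex set `V` (meant for finite `V`), given by its parent
function: `parent v = none` says that `v` is the root of its component, and `parent v = some u`
says that `u` is the parent of `v`. Well-foundedness excludes cycles. -/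
structure RootedForest (V : Type) where
  parent : V → Option V
  wf : WellFounded fun u v : V => parent v = some u

namespace RootedForest

variable {V : Type}

/-- The downward paths with `k` vertices in a rooted forest: sequences of vertices `v₁, …, v_k`
in which `v_i` is the parent of `v_{i+1}`. -/
def DownPath (F : RootedForest V) (k : ℕ) : Type :=
  {v : Fin k → V // ∀ i j : Fin k, (i : ℕ) + 1 = (j : ℕ) → F.parent (v j) = some (v i)}

/-- A downward path is a (consecutive) instance of the pattern `π`, with respect to a labeling `L`
of the vertices, if its sequence of labels is in the same relative order as `π`. -/
def IsInstance {F : RootedForest V} {k n : ℕ} (L : V ≃ Fin n) (π : Pattern k)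
    (p : F.DownPath k) : Prop :=
  ∀ i j : Fin k, L (p.1 i) < L (p.1 j) ↔ π i < π j

/-- The number of ways to label the vertices of `F` bijectively by `n` labels, where `n` is the
number of vertices, such that the set of all instances of `π` in `F` is exactly `S`. -/
noncomputable def numLabelings [Fintype V] (F : RootedForest V) {k : ℕ} (π : Pattern k)
    (S : Set (F.DownPath k)) : ℕ :=
  Nat.card {L : V ≃ Fin (Fintype.card V) // {p : F.DownPath k | IsInstance L π p} = S}

end RootedForest

/-- Super-strong c-forest-Wilf equivalence of two patterns of length `k`: for every finite rooted
forest `F` and every set `S` of highlighted downward paths with `k` vertices, there are equally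
many labelings whose set of instances of the pattern is `S`. -/
def SuperStrongEquiv {k : ℕ} (π π' : Pattern k) : Prop :=
  ∀ (V : Type) [Fintype V] (F : RootedForest V) (S : Set (F.DownPath k)),
    F.numLabelings π S = F.numLabelings π' S

open Finset

-- Summing over all supersets of `S` turns the hypothesis into an equality of the numbers of
-- labelings for which every path of a prescribed family is an instance. Such labelings are the
-- linear extensions of the relation that the pattern imposes on the paths
-- (`SuperStrongEquiv.lext_pathRel_eq`). Two families of paths for which these numbers can be
-- computed determine the pattern up to complement. Let the patterns have length `n + 1`, with
-- letters `0, …, n`.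
--
-- Sprouts: `m` paths start at vertex `i` of a main path. The shared vertex separates smaller labels
-- from larger ones, and on either side the paths are unrelated chains, so the count is a product of
-- two multinomial coefficients (`lext_sprout`). For `i = 0`, `m = 1` it is a product of two central
-- binomial coefficients; strict log-convexity gives `π' 0 = π 0` up to complement. Letting `m` vary
-- and comparing roots of polynomials in `m` then gives `π' i = π i`, unless `π 0` is the middle
-- letter, in which case `π' i` may also be the reflection of `π i`
-- (`SuperStrongEquiv.eq_or_of_head_eq`).
--
-- Brooms: it remains to show, for a middle first letter, that the reflections happen everywhere or
-- nowhere. After a complement, `π' 1 = π 1`; let `j` be the first position of disagreement. Paths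
-- sharing two vertices, and in bundles sharing all vertices up to `j`, split into three nontrivial
-- levels. Comparing one bundle with two shows that the product of the central binomial coefficients
-- of the level sizes of a bundle is invariant (`prod_centralBinom_tuft_eq`). The disagreement at
-- `j` alters exactly two of these sizes and preserves their sum, which log-convexity and a
-- divisibility argument exclude (`centralBinom_mul_ne_of_weights`).

-- Linear extensions of a relation on a finite set.

/-- The number of linear extensions of `r` on a set of `n` elements, counted by repeatedly removing
a minimal element. -/
noncomputable def lextAux {V : Type*} (r : V → V → Prop) : ℕ → Finset V → ℕ
  | 0, _ => 1
  | n + 1, A => by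
    classical exact ∑ a ∈ A with ∀ b ∈ A, ¬ r b a, lextAux r n (A.erase a)

/-- The number of linear extensions of the restriction of `r` to `A`. -/
noncomputable def lext {V : Type*} (r : V → V → Prop) (A : Finset V) : ℕ := lextAux r #A A

section lext

variable {V W : Type*}

@[simp] theorem lext_empty (r : V → V → Prop) : lext r ∅ = 1 := rfl

open Classical in
theorem lext_eq_sum [DecidableEq V] (r : V → V → Prop) {A : Finset V} (hA : A.Nonempty) :
    lext r A = ∑ a ∈ A with ∀ b ∈ A, ¬ r b a, lext r (A.erase a) := by
  obtain ⟨n, hn⟩ : ∃ n, #A = n + 1 := ⟨#A - 1, by have := hA.card_pos; omega⟩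
  rw [lext, hn, lextAux]
  refine sum_congr (by congr) fun a ha => ?_
  rw [lext, Subsingleton.elim (fun a b => Classical.propDecidable (a = b)) ‹DecidableEq V›, card_erase_of_mem (mem_filter.1 ha).1, hn, Nat.add_sub_cancel]

/-- Linear extensions written as enumerations of `A` in increasing order. -/
theorem card_enum_eq_lextAux (r : V → V → Prop) [Finite V] (n : ℕ) :
    ∀ A : Finset V, #A = n →
    Nat.card {f : Fin n → V // Function.Injective f ∧ (∀ i, f i ∈ A) ∧
      ∀ i j, r (f i) (f j) → i < j} = lextAux r n A := by
  classical
  induction n with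
  | zero =>
    intro A _
    rw [lextAux, Nat.card_eq_one_iff_unique]
    exact ⟨inferInstance, ⟨Fin.elim0, fun i => i.elim0, fun i => i.elim0, fun i => i.elim0⟩⟩
  | succ n ih =>
    intro A hA
    have := Fintype.ofFinite V
    have key : ∀ (a : V) (f : Fin n → V),
        (Function.Injective (Fin.cons a f : Fin (n + 1) → V) ∧
          (∀ i, (Fin.cons a f : Fin (n + 1) → V) i ∈ A) ∧
          ∀ i j, r ((Fin.cons a f : Fin (n + 1) → V) i) ((Fin.cons a f : Fin (n + 1) → V) j) →
            i < j) ↔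
        ((a ∈ A ∧ ∀ b ∈ A, ¬ r b a) ∧ Function.Injective f ∧ (∀ i, f i ∈ A.erase a) ∧
          ∀ i j, r (f i) (f j) → i < j) := by
      intro a f
      rw [Fin.cons_injective_iff]
      simp only [Fin.forall_fin_succ, Fin.cons_zero, Fin.cons_succ, Fin.succ_lt_succ_iff,
        Fin.succ_pos, Fin.not_lt_zero, mem_erase, Set.mem_range, not_exists]
      constructor
      · rintro ⟨⟨h1, h2⟩, ⟨h3, h4⟩, ⟨h5, h6⟩, h7⟩
        have hm : ∀ i, f i ∈ A.erase a := fun i => mem_erase.2 ⟨h1 i, h4 i⟩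
        -- The `n` distinct values of `f` exhaust `A.erase a`, so being first in the enumeration
        -- amounts to being minimal in all of `A`.
        have hsurj : univ.image f = A.erase a := by
          apply eq_of_subset_of_card_le
          · intro x hx
            obtain ⟨i, _, rfl⟩ := mem_image.1 hx
            exact hm i
          · rw [card_image_of_injective _ h2, card_erase_of_mem h3, hA]
            simp
        refine ⟨⟨h3, fun b hb => ?_⟩, h2, fun i => ⟨h1 i, h4 i⟩, fun i j h => (h7 i).2 j h⟩
        by_cases hba : b = a
        · subst hba; exact h5
        · have : b ∈ univ.image f := hsurj ▸ mem_erase.2 ⟨hba, hb⟩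
          obtain ⟨i, _, rfl⟩ := mem_image.1 this
          exact (h7 i).1
      · rintro ⟨⟨h1, h2⟩, h3, h4, h5⟩
        exact ⟨⟨fun i => (h4 i).1, h3⟩, ⟨h1, fun i => (h4 i).2⟩, ⟨h2 a h1, fun _ _ => trivial⟩,
          fun i => ⟨h2 _ (h4 i).2, fun j h => h5 i j h⟩⟩
    rw [lextAux]
    have e : {f : Fin (n + 1) → V // Function.Injective f ∧ (∀ i, f i ∈ A) ∧
        ∀ i j, r (f i) (f j) → i < j} ≃
        Σ a : V, {f : Fin n → V // (a ∈ A ∧ ∀ b ∈ A, ¬ r b a) ∧ Function.Injective f ∧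
          (∀ i, f i ∈ A.erase a) ∧ ∀ i j, r (f i) (f j) → i < j} :=
      { toFun := fun f => ⟨f.1 0, Fin.tail f.1, (key _ _).1 (by
          rw [Fin.cons_self_tail]; exact f.2)⟩
        invFun := fun x => ⟨Fin.cons x.1 x.2.1, (key _ _).2 x.2.2⟩
        left_inv := fun f => Subtype.ext (Fin.cons_self_tail f.1)
        right_inv := fun ⟨a, f⟩ => rfl }
    rw [Nat.card_congr e, Nat.card_sigma, sum_filter, ← sum_subset (subset_univ A)]
    · refine sum_congr rfl fun a ha => ?_
      split_ifs with h
      · rw [← ih (A.erase a) (by rw [card_erase_of_mem ha, hA]; rfl)]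
        exact Nat.card_congr (Equiv.subtypeEquivRight fun f => by simp only [and_iff_right_iff_imp]; exact fun _ => ⟨ha, h⟩)
      · rw [Nat.card_eq_zero]
        exact Or.inl ⟨fun f => h f.2.1.2⟩
    · intro a _ ha
      rw [Nat.card_eq_zero]
      exact Or.inl ⟨fun f => ha f.2.1.1⟩

/-- The labelings that are increasing along `r` are counted by `lext r univ`. -/
theorem card_labelings_eq_lext [Fintype V] (r : V → V → Prop) :
    Nat.card {L : V ≃ Fin (Fintype.card V) // ∀ u v, r u v → L u < L v} = lext r univ := by
  rw [lext, card_univ, ← card_enum_eq_lextAux r _ univ card_univ]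
  have hb : ∀ f : Fin (Fintype.card V) → V, Function.Injective f → Function.Bijective f :=
    fun f hf => (Fintype.bijective_iff_injective_and_card _).2 ⟨hf, by simp⟩
  refine Nat.card_congr
    { toFun := fun L => ⟨L.1.symm, L.1.symm.injective, fun _ => mem_univ _, fun i j h => by
        simpa using L.2 _ _ h⟩
      invFun := fun f => ⟨(Equiv.ofBijective f.1 (hb f.1 f.2.1)).symm, fun u v h => by
        apply f.2.2.2
        rwa [Equiv.ofBijective_apply_symm_apply f.1 (hb f.1 f.2.1),
          Equiv.ofBijective_apply_symm_apply f.1 (hb f.1 f.2.1)]⟩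
      left_inv := fun L => by
        apply Subtype.ext
        apply Equiv.symm_bijective.injective
        ext; rfl
      right_inv := fun f => by
        apply Subtype.ext
        ext; rfl }

theorem lext_image [DecidableEq W] (r : V → V → Prop) (s : W → W → Prop) (φ : V → W) :
    ∀ A : Finset V, Set.InjOn φ A → (∀ u ∈ A, ∀ v ∈ A, r u v ↔ s (φ u) (φ v)) →
      lext s (A.image φ) = lext r A := by
  classical
  intro A
  induction A using Finset.strongInduction with
  | H A ih =>
    intro hφ hrs
    rcases A.eq_empty_or_nonempty with rfl | hA
    · simp
    · rw [lext_eq_sum r hA, lext_eq_sum s (hA.image φ)]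
      symm
      apply sum_bij (fun a _ => φ a)
      · intro a ha
        simp only [mem_filter, mem_image] at ha ⊢
        refine ⟨⟨a, ha.1, rfl⟩, ?_⟩
        rintro _ ⟨b, hb, rfl⟩ h
        exact ha.2 b hb ((hrs b hb a ha.1).2 h)
      · intro a ha b hb h
        exact hφ (mem_filter.1 ha).1 (mem_filter.1 hb).1 h
      · intro b hb
        simp only [mem_filter, mem_image] at hb
        obtain ⟨⟨a, ha, rfl⟩, hb⟩ := hb
        refine ⟨a, mem_filter.2 ⟨ha, fun c hc h => hb _ ⟨c, hc, rfl⟩ ((hrs c hc a ha).1 h)⟩, rfl⟩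
      · intro a ha
        have ha' := (mem_filter.1 ha).1
        rw [← ih (A.erase a) (erase_ssubset ha')
          (hφ.mono (by simp)) (fun u hu v hv =>
            hrs u (mem_of_mem_erase hu) v (mem_of_mem_erase hv))]
        congr 1
        ext x
        simp only [mem_image, mem_erase]
        constructor
        · rintro ⟨u, ⟨h1, h2⟩, rfl⟩
          exact ⟨fun h => h1 (hφ h2 ha' h), u, h2, rfl⟩
        · rintro ⟨h1, u, h2, rfl⟩
          exact ⟨u, ⟨fun h => h1 (by rw [h]), h2⟩, rfl⟩

theorem lext_congr (r s : V → V → Prop) (A : Finset V)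
    (h : ∀ u ∈ A, ∀ v ∈ A, r u v ↔ s u v) : lext s A = lext r A := by
  classical
  simpa using lext_image r s id A (Set.injOn_id _) h

theorem lext_chain (r : V → V → Prop) (val : V → ℕ) : ∀ A : Finset V, Set.InjOn val A →
    (∀ u ∈ A, ∀ v ∈ A, r u v ↔ val u < val v) → lext r A = 1 := by
  classical
  intro A
  induction A using Finset.strongInduction with
  | H A ih =>
    intro hv hr
    rcases A.eq_empty_or_nonempty with rfl | hA
    · simp
    · obtain ⟨a, ha, hmin⟩ := exists_min_image A val hA
      have : ({a ∈ A | ∀ b ∈ A, ¬ r b a} : Finset V) = {a} := by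
        ext x
        simp only [mem_filter, mem_singleton]
        constructor
        · rintro ⟨hx, h⟩
          have h1 := h a ha
          rw [hr a ha x hx] at h1
          exact hv hx ha (le_antisymm (not_lt.1 h1) (hmin x hx))
        · rintro rfl
          exact ⟨ha, fun b hb => by rw [hr b hb x ha]; exact not_lt.2 (hmin b hb)⟩
      rw [lext_eq_sum r hA, this, sum_singleton]
      exact ih _ (erase_ssubset ha) (hv.mono (by simp))
        fun u hu v hv => hr u (mem_of_mem_erase hu) v (mem_of_mem_erase hv)

theorem lext_union_of_lt [DecidableEq V] (r : V → V → Prop) (B : Finset V) : ∀ A : Finset V,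
    (∀ a ∈ A, ∀ b ∈ B, r a b ∧ ¬ r b a) → lext r (A ∪ B) = lext r A * lext r B := by
  classical
  intro A
  induction A using Finset.strongInduction with
  | H A ih =>
    intro h
    rcases A.eq_empty_or_nonempty with rfl | hA
    · simp
    · rw [lext_eq_sum r hA, lext_eq_sum r (hA.mono subset_union_left), sum_mul]
      refine sum_congr ?_ ?_
      · ext x
        simp only [mem_filter, mem_union]
        constructor
        · rintro ⟨hx | hx, hx'⟩
          · exact ⟨hx, fun b hb => hx' b (Or.inl hb)⟩
          · obtain ⟨a, ha⟩ := hA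
            exact absurd (h a ha x hx).1 (hx' a (Or.inl ha))
        · rintro ⟨hx, hx'⟩
          exact ⟨Or.inl hx, fun b hb => hb.elim (hx' b) fun hb => (h x hx b hb).2⟩
      · intro a ha
        have ha' := (mem_filter.1 ha).1
        have haB : a ∉ B := fun hB => (h a ha' a hB).2 (h a ha' a hB).1
        rw [← ih _ (erase_ssubset ha') fun x hx => h x (mem_of_mem_erase hx), erase_union_distrib,
          erase_eq_of_notMem haB]

/-- The first element of an extension is minimal in `A` or minimal in `B`; Pascal's rule adds up the
two cases. -/
theorem lext_union_of_unrelated [DecidableEq V] (r : V → V → Prop) (n : ℕ) : ∀ A B : Finset V,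
    #A + #B = n → Disjoint A B → (∀ a ∈ A, ∀ b ∈ B, ¬ r a b ∧ ¬ r b a) →
    lext r (A ∪ B) = (#A + #B).choose #A * lext r A * lext r B := by
  classical
  induction n with
  | zero =>
    intro A B hn hAB h
    obtain ⟨rfl, rfl⟩ : A = ∅ ∧ B = ∅ := by
      constructor <;> apply card_eq_zero.1 <;> omega
    simp
  | succ n ih =>
    intro A B hn hAB h
    rcases A.eq_empty_or_nonempty with rfl | hA
    · simp
    rcases B.eq_empty_or_nonempty with rfl | hB
    · simp
    rw [lext_eq_sum r (hA.mono subset_union_left)]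
    have hsplit : ({a ∈ A ∪ B | ∀ b ∈ A ∪ B, ¬ r b a} : Finset V) =
        {a ∈ A | ∀ b ∈ A, ¬ r b a} ∪ {a ∈ B | ∀ b ∈ B, ¬ r b a} := by
      ext x
      simp only [mem_filter, mem_union]
      constructor
      · rintro ⟨hx | hx, hx'⟩
        · exact Or.inl ⟨hx, fun b hb => hx' b (Or.inl hb)⟩
        · exact Or.inr ⟨hx, fun b hb => hx' b (Or.inr hb)⟩
      · rintro (⟨hx, hx'⟩ | ⟨hx, hx'⟩)
        · exact ⟨Or.inl hx, fun b hb => hb.elim (hx' b) fun hb => (h x hx b hb).2⟩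
        · exact ⟨Or.inr hx, fun b hb => hb.elim (fun hb => (h b hb x hx).1) (hx' b)⟩
    rw [hsplit, sum_union (hAB.mono (filter_subset _ _) (filter_subset _ _))]
    obtain ⟨p, hp⟩ : ∃ p, #A = p + 1 := ⟨#A - 1, by have := hA.card_pos; omega⟩
    obtain ⟨q, hq⟩ : ∃ q, #B = q + 1 := ⟨#B - 1, by have := hB.card_pos; omega⟩
    have h1 : ∑ a ∈ A with ∀ b ∈ A, ¬ r b a, lext r ((A ∪ B).erase a) =
        (p + q + 1).choose p * lext r A * lext r B := by
      rw [lext_eq_sum r hA, mul_sum, sum_mul]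
      refine sum_congr rfl fun a ha => ?_
      have ha' := (mem_filter.1 ha).1
      have hc : #(A.erase a) = p := by rw [card_erase_of_mem ha', hp]; rfl
      rw [erase_union_distrib, erase_eq_of_notMem (disjoint_left.1 hAB ha'),
        ih _ _ (by omega) (hAB.mono_left (erase_subset _ _))
          fun x hx => h x (mem_of_mem_erase hx), hc, hq]
      rfl
    have h2 : ∑ a ∈ B with ∀ b ∈ B, ¬ r b a, lext r ((A ∪ B).erase a) =
        (p + q + 1).choose (p + 1) * lext r A * lext r B := by
      rw [lext_eq_sum r hB, mul_sum]
      refine sum_congr rfl fun a ha => ?_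
      have ha' := (mem_filter.1 ha).1
      have hc : #(B.erase a) = q := by rw [card_erase_of_mem ha', hq]; rfl
      rw [erase_union_distrib, erase_eq_of_notMem (disjoint_right.1 hAB ha'),
        ih _ _ (by omega) (hAB.mono_right (erase_subset _ _))
          fun x hx y hy => h x hx y (mem_of_mem_erase hy), hc, hp]
      rw [show p + 1 + q = p + q + 1 by ring]
    rw [h1, h2, hp, hq, show p + 1 + (q + 1) = (p + q + 1) + 1 by ring,
      Nat.choose_succ_succ (p + q + 1)]
    ring

/-- The fraction of all orderings of `A` that are linear extensions is multiplicative over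
mutually unrelated parts. -/
theorem lext_div_factorial_eq_prod {ι : Type*} [Fintype ι] [DecidableEq ι] (r : V → V → Prop)
    (A : Finset V) (f : V → ι) (h : ∀ u ∈ A, ∀ v ∈ A, r u v → f u = f v) :
    (lext r A / (#A).factorial : ℚ) =
      ∏ c, (lext r {v ∈ A | f v = c} / (#{v ∈ A | f v = c}).factorial : ℚ) := by
  classical
  have key : ∀ J : Finset ι, (lext r {v ∈ A | f v ∈ J} / (#{v ∈ A | f v ∈ J}).factorial : ℚ) =
      ∏ c ∈ J, (lext r {v ∈ A | f v = c} / (#{v ∈ A | f v = c}).factorial : ℚ) := by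
    intro J
    induction J using Finset.induction_on with
    | empty => simp
    | insert c J hc ih =>
      rw [prod_insert hc, ← ih]
      have hd : Disjoint {v ∈ A | f v = c} {v ∈ A | f v ∈ J} :=
        disjoint_filter.2 fun x _ h1 h2 => hc (h1 ▸ h2)
      have hu : ({v ∈ A | f v ∈ insert c J} : Finset V) =
          {v ∈ A | f v = c} ∪ {v ∈ A | f v ∈ J} := by
        rw [← filter_or]; simp only [mem_insert]
      rw [hu, lext_union_of_unrelated r _ _ _ rfl hd, card_union_of_disjoint hd]
      · have := Nat.add_choose_mul_factorial_mul_factorial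
          (#{v ∈ A | f v ∈ J}) (#{v ∈ A | f v = c})
        rw [add_comm] at this
        rw [← this]
        push_cast
        have h1 : ((#{v ∈ A | f v = c}).factorial : ℚ) ≠ 0 := by positivity
        have h2 : ((#{v ∈ A | f v ∈ J}).factorial : ℚ) ≠ 0 := by positivity
        have h3 : (((#{v ∈ A | f v = c} + #{v ∈ A | f v ∈ J}).choose
            #{v ∈ A | f v = c} : ℕ) : ℚ) ≠ 0 := by
          exact_mod_cast (Nat.choose_pos (Nat.le_add_right _ _)).ne'
        field_simp
      · intro a ha b hb
        simp only [mem_filter] at ha hb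
        exact ⟨fun hr => hc (by rw [← ha.2, h a ha.1 b hb.1 hr]; exact hb.2),
          fun hr => hc (by rw [← ha.2, ← h b hb.1 a ha.1 hr]; exact hb.2)⟩
  simpa using key univ

/-- Linear extensions split along a level function whose levels are separated by `r`. -/
theorem lext_eq_prod_levels [Fintype V] (r : V → V → Prop) (lev : V → ℕ) (T : ℕ)
    (hT : ∀ v, lev v < T) (hle : ∀ u v, r u v → lev u ≤ lev v)
    (hlt : ∀ u v, lev u < lev v → Relation.TransGen r u v) :
    lext r univ = ∏ t ∈ range T, lext r {v | lev v = t} := by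
  classical
  -- Comparisons between different levels already follow from `r` by transitivity, so adding them
  -- changes no count; with them present the levels can be peeled off one by one.
  set s : V → V → Prop := fun u v => lev u < lev v ∨ r u v with hs
  have h1 : lext r univ = lext s univ := by
    rw [← card_labelings_eq_lext, ← card_labelings_eq_lext]
    refine Nat.card_congr (Equiv.subtypeEquivRight fun L => ⟨fun h u v huv => ?_,
      fun h u v huv => h u v (Or.inr huv)⟩)
    rcases huv with huv | huv
    · have := hlt u v huv
      clear huv
      induction this with
      | single h1 => exact h _ _ h1
      | tail _ h1 ih => exact ih.trans (h _ _ h1)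
    · exact h u v huv
  have key : ∀ T, lext s {v | lev v < T} = ∏ t ∈ range T, lext s {v | lev v = t} := by
    intro T
    induction T with
    | zero => simp
    | succ T ih =>
      rw [prod_range_succ, ← ih, ← lext_union_of_lt, ← filter_or]
      · simp only [Nat.lt_succ_iff_lt_or_eq]
      · intro a ha b hb
        simp only [mem_filter, mem_univ, true_and] at ha hb
        refine ⟨Or.inl (by omega), ?_⟩
        rintro (h | h)
        · omega
        · have := hle _ _ h; omega
  have h2 := key T
  rw [filter_true_of_mem fun v _ => hT v] at h2
  rw [h1, h2]
  refine prod_congr rfl fun t _ => lext_congr _ _ _ fun u hu v hv => ?_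
  simp only [mem_filter, mem_univ, true_and] at hu hv
  simp [hs, hu, hv]

end lext

-- Log-convexity of central binomial coefficients, and a factorial identity in a parameter.

section arithmetic

/-- The ratio of consecutive central binomial coefficients, `2 * (2 * t + 1) / (t + 1) = 4 - 2 / (t
+ 1)`, increases strictly with `t`. -/
theorem centralBinom_mul_lt {s t : ℕ} (h : t < s) :
    (t + 1).centralBinom * s.centralBinom < t.centralBinom * (s + 1).centralBinom := by
  have h1 := Nat.succ_mul_centralBinom_succ t
  have h2 := Nat.succ_mul_centralBinom_succ s
  have p1 := t.centralBinom_pos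
  have p2 := s.centralBinom_pos
  have hlt : (s + 1) * (2 * (2 * t + 1)) < (t + 1) * (2 * (2 * s + 1)) := by nlinarith
  refine lt_of_mul_lt_mul_left (a := (t + 1) * (s + 1)) ?_ (Nat.zero_le _)
  calc (t + 1) * (s + 1) * ((t + 1).centralBinom * s.centralBinom)
      = ((t + 1) * (t + 1).centralBinom) * ((s + 1) * s.centralBinom) := by ring
    _ = ((s + 1) * (2 * (2 * t + 1))) * (t.centralBinom * s.centralBinom) := by rw [h1]; ring
    _ < ((t + 1) * (2 * (2 * s + 1))) * (t.centralBinom * s.centralBinom) :=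
        Nat.mul_lt_mul_of_pos_right hlt (Nat.mul_pos p1 p2)
    _ = ((s + 1) * (s + 1).centralBinom) * ((t + 1) * t.centralBinom) := by rw [h2]; ring
    _ = _ := by ring

/-- The central binomial coefficients are strictly log-convex. -/
theorem centralBinom_mul_lt_of_pos (t : ℕ) {d e : ℕ} (hd : 0 < d) (he : 0 < e) :
    (t + d).centralBinom * (t + e).centralBinom < t.centralBinom * (t + d + e).centralBinom := by
  induction d, hd using Nat.le_induction with
  | base => simpa [add_right_comm] using centralBinom_mul_lt (Nat.lt_add_of_pos_right he (n := t))
  | succ d hd ih =>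
    have h1 := centralBinom_mul_lt (Nat.lt_add_of_pos_right he (n := t + d))
    have h2 := Nat.mul_lt_mul'' h1 ih
    rw [← add_assoc, add_right_comm (t + d) 1 e]
    refine lt_of_mul_lt_mul_left (a := (t + d).centralBinom * (t + d + e).centralBinom) ?_
      (Nat.zero_le _)
    calc _ = (t + d + 1).centralBinom * (t + d + e).centralBinom *
          ((t + d).centralBinom * (t + e).centralBinom) := by ring
      _ < _ := h2
      _ = _ := by ring

/-- The sum and the product of the central binomial coefficients determine two numbers. -/
theorem eq_or_eq_of_centralBinom_mul_eq {s t s' t' : ℕ} (hsum : s + t = s' + t')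
    (hprod : s.centralBinom * t.centralBinom = s'.centralBinom * t'.centralBinom) :
    s = s' ∨ s = t' := by
  by_contra! hne
  -- Two different pairs with equal sums are nested, one strictly inside the other; the four cases
  -- below are the possible positions of the smallest number `m`.
  have key : ∀ m d e, 0 < d → 0 < e → (m + d).centralBinom * (m + e).centralBinom ≠
      m.centralBinom * (m + d + e).centralBinom :=
    fun m d e hd he => (centralBinom_mul_lt_of_pos m hd he).ne
  rcases lt_or_gt_of_ne hne.1 with h1 | h1 <;> rcases lt_or_gt_of_ne hne.2 with h2 | h2
  · obtain ⟨d, rfl⟩ := Nat.exists_eq_add_of_lt h1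
    obtain ⟨e, rfl⟩ := Nat.exists_eq_add_of_lt h2
    obtain rfl : t = s + (d + 1) + (e + 1) := by omega
    exact key s (d + 1) (e + 1) (by omega) (by omega) hprod.symm
  · obtain ⟨d, rfl⟩ := Nat.exists_eq_add_of_lt h2
    obtain ⟨e, rfl⟩ := Nat.exists_eq_add_of_lt h1
    obtain rfl : t = t' + (e + 1) := by omega
    exact key t' (d + 1) (e + 1) (by omega) (by omega) (by
      rw [mul_comm _ t'.centralBinom] at hprod; exact hprod)
  · obtain ⟨d, rfl⟩ := Nat.exists_eq_add_of_lt h1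
    obtain ⟨e, rfl⟩ := Nat.exists_eq_add_of_lt h2
    obtain rfl : t = s' + (e + 1) := by omega
    exact key s' (d + 1) (e + 1) (by omega) (by omega) hprod
  · obtain ⟨d, rfl⟩ : ∃ d, s' = t + d := ⟨s' - t, by omega⟩
    obtain ⟨e, rfl⟩ : ∃ e, t' = t + e := ⟨t' - t, by omega⟩
    obtain rfl : s = t + d + e := by omega
    exact key t d e (by omega) (by omega) (by rw [← hprod, mul_comm])

theorem factorial_eq_mul_prod_Ioc (c : ℕ) {x x' : ℕ} (h : x ≤ x') :
    (x' + c).factorial = (x + c).factorial * ∏ j ∈ Ioc x x', (j + c) := by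
  induction x', h using Nat.le_induction with
  | base => simp
  | succ x' h ih =>
    rw [prod_Ioc_succ_top h, show x' + 1 + c = (x' + c) + 1 by ring, Nat.factorial_succ, ih]
    ring

/-- The two sequences of linear factors below agree for all `m` only if their roots agree. -/
theorem exists_mul_eq_of_prod_eq {a b x x' y y' : ℕ}
    (h : ∀ m : ℕ, (∏ j ∈ Ioc x x', (j + m * a)) * ∏ j ∈ Ioc y' y, j =
      (∏ j ∈ Ioc y' y, (j + m * b)) * ∏ j ∈ Ioc x x', j) (hb : 0 < b)
    {i : ℕ} (hi : i ∈ Ioc y' y) : ∃ j ∈ Ioc x x', j * b = i * a := by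
  have hpoly : (∏ j ∈ Ioc x x', (Polynomial.C (j : ℚ) + Polynomial.X * Polynomial.C (a : ℚ))) *
      Polynomial.C (∏ j ∈ Ioc y' y, (j : ℚ)) =
      (∏ j ∈ Ioc y' y, (Polynomial.C (j : ℚ) + Polynomial.X * Polynomial.C (b : ℚ))) *
      Polynomial.C (∏ j ∈ Ioc x x', (j : ℚ)) := by
    refine Polynomial.eq_of_infinite_eval_eq _ _
      ((Set.infinite_range_of_injective (Nat.cast_injective (R := ℚ))).mono ?_)
    rintro _ ⟨m, rfl⟩
    have := congrArg (Nat.cast : ℕ → ℚ) (h m)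
    push_cast at this
    simp only [Set.mem_ofPred_eq, Polynomial.eval_mul, Polynomial.eval_prod, Polynomial.eval_add,
      Polynomial.eval_C, Polynomial.eval_X]
    exact this
  -- Evaluation at the root of the factor `i + X * b` on the right forces some factor `j + X * a` on
  -- the left to vanish there.
  have hev := congrArg (Polynomial.eval (-(i : ℚ) / b)) hpoly
  have hb' : (b : ℚ) ≠ 0 := by exact_mod_cast hb.ne'
  simp only [Polynomial.eval_mul, Polynomial.eval_prod, Polynomial.eval_add,
    Polynomial.eval_C, Polynomial.eval_X] at hev
  rw [prod_eq_zero (s := Ioc y' y) (f := fun j : ℕ => (j : ℚ) + -(i : ℚ) / b * b) hi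
    (by field_simp; ring), zero_mul, mul_eq_zero] at hev
  rcases hev with hev | hev
  · obtain ⟨j, hj, hj'⟩ := prod_eq_zero_iff.1 hev
    refine ⟨j, hj, ?_⟩
    field_simp at hj'
    have : (j * b : ℚ) = i * a := by linarith
    exact_mod_cast this
  · obtain ⟨j, hj, hj'⟩ := prod_eq_zero_iff.1 hev
    simp only [mem_Ioc] at hj
    norm_cast at hj'
    omega

/-- After common factorials are cancelled, both sides are products of linear factors in `m`. The
extreme roots on the two sides must coincide, which gives the proportions `A` and `B`; their
difference gives `a = b`, unless each side has only one factor. -/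
theorem eq_and_eq_of_factorial_eq_of_lt {n a b x y x' y' : ℕ} (hab : a + b = n)
    (hxy : x + y = n) (hxy' : x' + y' = n)
    (h : ∀ m : ℕ, (x + m * a).factorial * (y + m * b).factorial * (x'.factorial * y'.factorial) =
      (x' + m * a).factorial * (y' + m * b).factorial * (x.factorial * y.factorial))
    (hlt : x < x') : a = b ∧ x' = y := by
  have hlt' : y' < y := by omega
  have hprod : ∀ m : ℕ, (∏ j ∈ Ioc x x', (j + m * a)) * ∏ j ∈ Ioc y' y, j =
      (∏ j ∈ Ioc y' y, (j + m * b)) * ∏ j ∈ Ioc x x', j := by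
    intro m
    have h0 := h m
    have e1 := factorial_eq_mul_prod_Ioc 0 hlt.le
    have e2 := factorial_eq_mul_prod_Ioc 0 hlt'.le
    simp only [add_zero] at e1 e2
    rw [factorial_eq_mul_prod_Ioc _ hlt.le, factorial_eq_mul_prod_Ioc _ hlt'.le, e1, e2] at h0
    have hpos : 0 < (x + m * a).factorial * (y' + m * b).factorial *
      (x.factorial * y'.factorial) := by positivity
    refine Nat.eq_of_mul_eq_mul_left hpos ?_
    linarith
  have hl : x' ∈ Ioc x x' := by simp [hlt]
  have hl1 : x + 1 ∈ Ioc x x' := by simp; omega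
  have hr : y ∈ Ioc y' y := by simp [hlt']
  have hr1 : y' + 1 ∈ Ioc y' y := by simp; omega
  have ha : 0 < a := by
    by_contra h0
    obtain rfl : a = 0 := by omega
    obtain ⟨j, hj, hj'⟩ := exists_mul_eq_of_prod_eq hprod (by omega) hr
    simp at hj hj'
    omega
  have hb : 0 < b := by
    by_contra h0
    obtain rfl : b = 0 := by omega
    obtain ⟨j, hj, hj'⟩ := exists_mul_eq_of_prod_eq (fun m => (hprod m).symm) ha hl
    simp at hj hj'
    omega
  obtain ⟨j1, hj1, e1⟩ := exists_mul_eq_of_prod_eq hprod hb hr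
  obtain ⟨j2, hj2, e2⟩ := exists_mul_eq_of_prod_eq hprod hb hr1
  obtain ⟨j3, hj3, e3⟩ := exists_mul_eq_of_prod_eq (fun m => (hprod m).symm) ha hl
  obtain ⟨j4, hj4, e4⟩ := exists_mul_eq_of_prod_eq (fun m => (hprod m).symm) ha hl1
  simp only [mem_Ioc] at hj1 hj2 hj3 hj4
  have A : x' * b = y * a := le_antisymm
    (by rw [← e3]; exact Nat.mul_le_mul_right _ hj3.2)
    (by rw [← e1]; exact Nat.mul_le_mul_right _ hj1.2)
  have B : (x + 1) * b = (y' + 1) * a := le_antisymm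
    (by rw [← e2]; exact Nat.mul_le_mul_right _ hj2.1)
    (by rw [← e4]; exact Nat.mul_le_mul_right _ hj4.1)
  obtain ⟨d, rfl⟩ := Nat.exists_eq_add_of_lt hlt
  obtain rfl : y = y' + d + 1 := by omega
  have hdab : d * b = d * a := by nlinarith
  -- For `d = 0` there is a single factor on each side and `A` reads `n * (x + 1) = a * (n + 1)`. As
  -- `n` is coprime to `n + 1`, it divides `a`, impossible for `0 < a < n`.
  rcases Nat.eq_zero_or_pos d with rfl | hd
  · exfalso
    have hk : n * (x + 1) = a * (n + 1) := by
      have : n = x + y' + 1 := by omega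
      nlinarith
    have hdvd : n ∣ a := by
      have : n ∣ a * (n + 1) := ⟨_, hk.symm⟩
      exact (Nat.Coprime.dvd_mul_right (by simp)).1 this
    have := Nat.le_of_dvd ha hdvd
    omega
  · obtain rfl := Nat.eq_of_mul_eq_mul_left hd hdab
    exact ⟨rfl, Nat.eq_of_mul_eq_mul_right ha A⟩

theorem eq_or_eq_of_factorial_eq {n a b x y x' y' : ℕ} (hab : a + b = n)
    (hxy : x + y = n) (hxy' : x' + y' = n)
    (h : ∀ m : ℕ, (x + m * a).factorial * (y + m * b).factorial * (x'.factorial * y'.factorial) =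
      (x' + m * a).factorial * (y' + m * b).factorial * (x.factorial * y.factorial)) :
    x' = x ∨ (a = b ∧ x' = y) := by
  rcases lt_trichotomy x x' with hlt | heq | hlt
  · exact Or.inr (eq_and_eq_of_factorial_eq_of_lt hab hxy hxy' h hlt)
  · exact Or.inl heq.symm
  · have := eq_and_eq_of_factorial_eq_of_lt hab hxy' hxy (fun m => (h m).symm) hlt
    exact Or.inr ⟨this.1, by omega⟩

end arithmetic

-- From labelings with prescribed instances to linear extensions.

namespace RootedForest

variable {V : Type}

instance [Finite V] (F : RootedForest V) (k : ℕ) : Finite (F.DownPath k) :=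
  inferInstanceAs (Finite {_v : Fin k → V // _})

theorem isInstance_complement {F : RootedForest V} {k n : ℕ} (L : V ≃ Fin n) (π : Pattern k)
    (p : F.DownPath k) :
    IsInstance (L.trans Fin.revPerm) π.complement p ↔ IsInstance L π p := by
  simp only [IsInstance, Pattern.complement, Equiv.trans_apply, Fin.revPerm_apply, Fin.rev_lt_rev]
  exact forall_comm

theorem numLabelings_complement [Fintype V] (F : RootedForest V) {k : ℕ} (π : Pattern k)
    (S : Set (F.DownPath k)) : F.numLabelings π.complement S = F.numLabelings π S := by
  symm
  refine Nat.card_congr (((Equiv.refl V).equivCongr Fin.revPerm).subtypeEquiv fun L => ?_)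
  have : (Equiv.refl V).equivCongr Fin.revPerm L = L.trans Fin.revPerm := rfl
  rw [this]
  simp only [isInstance_complement]

/-- The number of labelings for which every path of `S` is an instance. -/
theorem card_subset_instances [Fintype V] (F : RootedForest V) {k : ℕ} (π : Pattern k)
    (S : Set (F.DownPath k)) [Fintype (Set (F.DownPath k))] :
    Nat.card {L : V ≃ Fin (Fintype.card V) // S ⊆ {p : F.DownPath k | IsInstance L π p}} =
      ∑ T : Set (F.DownPath k), Nat.card {_x : Unit // S ⊆ T} * F.numLabelings π T := by
  -- The labelings are sorted by their exact instance set `T`; the subtype of `Unit` serves as the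
  -- indicator of `S ⊆ T`.
  have e : {L : V ≃ Fin (Fintype.card V) // S ⊆ {p : F.DownPath k | IsInstance L π p}} ≃
      Σ T : Set (F.DownPath k), {_x : Unit // S ⊆ T} ×
        {L : V ≃ Fin (Fintype.card V) // {p : F.DownPath k | IsInstance L π p} = T} :=
    { toFun := fun L => ⟨_, ⟨(), L.2⟩, L.1, rfl⟩
      invFun := fun x => ⟨x.2.2.1, x.2.2.2.symm ▸ x.2.1.2⟩
      left_inv := fun _ => rfl
      right_inv := by rintro ⟨_, ⟨_, _⟩, _, rfl⟩; rfl }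
  rw [Nat.card_congr e, Nat.card_sigma]
  simp only [Nat.card_prod, numLabelings]

end RootedForest

theorem Pattern.complement_complement {k : ℕ} (π : Pattern k) : π.complement.complement = π := by
  ext i
  simp [Pattern.complement]

theorem SuperStrongEquiv.symm {k : ℕ} {π π' : Pattern k} (h : SuperStrongEquiv π π') :
    SuperStrongEquiv π' π :=
  fun V _ F S => (h V F S).symm

theorem SuperStrongEquiv.complement_right {k : ℕ} {π π' : Pattern k}
    (h : SuperStrongEquiv π π') : SuperStrongEquiv π π'.complement :=
  fun V _ F S => (h V F S).trans (F.numLabelings_complement π' S).symm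

theorem SuperStrongEquiv.complement_left {k : ℕ} {π π' : Pattern k}
    (h : SuperStrongEquiv π π') : SuperStrongEquiv π.complement π' :=
  h.symm.complement_right.symm

/-- The order constraints forced on the labels by making every path of the family `P` an instance
of `π`. -/
def pathRel {V ι : Type*} {k : ℕ} (P : ι → Fin k → V) (π : Pattern k) (u v : V) : Prop :=
  ∃ c i j, π i < π j ∧ P c i = u ∧ P c j = v

open RootedForest in
theorem SuperStrongEquiv.lext_pathRel_eq {k : ℕ} {π π' : Pattern k} (h : SuperStrongEquiv π π')
    {V ι : Type} [Fintype V] (F : RootedForest V) (P : ι → F.DownPath k) :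
    lext (pathRel (fun c => (P c).1) π) univ = lext (pathRel (fun c => (P c).1) π') univ := by
  have key : ∀ π : Pattern k, lext (pathRel (fun c => (P c).1) π) univ =
      Nat.card {L : V ≃ Fin (Fintype.card V) //
        Set.range P ⊆ {p : F.DownPath k | IsInstance L π p}} := by
    intro π
    rw [← card_labelings_eq_lext]
    refine Nat.card_congr (Equiv.subtypeEquivRight fun L => ⟨?_, ?_⟩)
    · rintro hL _ ⟨c, rfl⟩ i j
      refine ⟨fun hlt => ?_, fun hlt => hL _ _ ⟨c, i, j, hlt, rfl, rfl⟩⟩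
      by_contra hle
      rcases (not_lt.1 hle).eq_or_lt with heq | hlt'
      · rw [π.injective heq] at hlt
        exact lt_irrefl _ hlt
      · exact lt_asymm hlt (hL _ _ ⟨c, j, i, hlt', rfl, rfl⟩)
    · rintro hL _ _ ⟨c, i, j, hlt, rfl, rfl⟩
      exact (hL ⟨c, rfl⟩ i j).2 hlt
  have := Fintype.ofFinite (Set (F.DownPath k))
  rw [key, key, card_subset_instances, card_subset_instances]
  exact sum_congr rfl fun T _ => by rw [h V F T]

/-- A version for path families in a vertex set with a depth function, in which all paths through
a vertex agree on its parent. -/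
theorem SuperStrongEquiv.lext_eq {n : ℕ} {π π' : Pattern (n + 1)} (h : SuperStrongEquiv π π')
    {V ι : Type} [Fintype V] (P : ι → Fin (n + 1) → V) (parent : V → Option V) (depth : V → ℕ)
    (hdepth : ∀ u v, parent v = some u → depth u < depth v)
    (hP : ∀ c (i : Fin n), parent (P c i.succ) = some (P c i.castSucc)) :
    lext (pathRel P π) univ = lext (pathRel P π') univ :=
  h.lext_pathRel_eq ⟨parent, Subrelation.wf (hdepth _ _) (measure depth).wf⟩
    fun c => ⟨P c, fun i j hij => by
      have hi : (i : ℕ) < n := by omega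
      obtain rfl : j = (⟨i, hi⟩ : Fin n).succ := Fin.ext hij.symm
      exact hP c ⟨i, hi⟩⟩

-- Letters compared with a pivot letter.

/-- `0`, `1` or `2` according to whether `w` is smaller than, equal to or larger than `z`. -/
def cmpLevel {k : ℕ} (z w : Fin k) : ℕ := if w < z then 0 else if w = z then 1 else 2

section cmpLevel

variable {k : ℕ} (z : Fin k)

theorem cmpLevel_lt_three (w : Fin k) : cmpLevel z w < 3 := by
  unfold cmpLevel; split_ifs <;> omega

@[simp] theorem cmpLevel_eq_zero {w : Fin k} : cmpLevel z w = 0 ↔ w < z := by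
  unfold cmpLevel; split_ifs with h1 h2 <;> simp [h1]

@[simp] theorem cmpLevel_eq_one {w : Fin k} : cmpLevel z w = 1 ↔ w = z := by
  unfold cmpLevel; split_ifs with h1 h2
  · simp [h1.ne]
  · simp [h2]
  · simp [h2]

@[simp] theorem cmpLevel_eq_two {w : Fin k} : cmpLevel z w = 2 ↔ z < w := by
  unfold cmpLevel; split_ifs with h1 h2
  · simp [h1.le]
  · simp [h2]
  · simpa using lt_of_le_of_ne (not_lt.1 h1) (Ne.symm h2)

theorem cmpLevel_mono : Monotone (cmpLevel z) := by
  intro v w h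
  unfold cmpLevel
  split_ifs <;> omega

theorem exists_pivot_of_cmpLevel_lt {v w : Fin k} (h : cmpLevel z v < cmpLevel z w) :
    v ≤ z ∧ z ≤ w ∧ v < w := by
  unfold cmpLevel at h
  split_ifs at h <;> omega

theorem card_cmpLevel_zero (π : Pattern k) : #{t | cmpLevel z (π t) = 0} = z := by
  simp only [cmpLevel_eq_zero]
  rw [← Fin.card_Iio z]
  exact card_equiv π (by simp)

theorem card_cmpLevel_two (π : Pattern k) : #{t | cmpLevel z (π t) = 2} = k - 1 - z := by
  simp only [cmpLevel_eq_two]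
  rw [← Fin.card_Ioi z]
  exact card_equiv π (by simp)

end cmpLevel

-- Sprouts: paths attached to one vertex of a main path.

/-- The path family consisting of a main path and of `m` more paths, all of which start at vertex
`i` of the main path. -/
def sproutPath {n : ℕ} (m : ℕ) (i : Fin (n + 1)) :
    Option (Fin m) → Fin (n + 1) → Fin (n + 1) ⊕ Fin m × Fin n
  | none => Sum.inl
  | some c => Fin.cases (Sum.inl i) fun t => Sum.inr (c, t)

section sprout

variable {n m : ℕ} (i : Fin (n + 1))

/-- The path on which a vertex lies; the common vertex `i` counts for the main path. -/
def sproutIndex : Fin (n + 1) ⊕ Fin m × Fin n → Option (Fin m)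
  | Sum.inl _ => none
  | Sum.inr x => some x.1

/-- The position of the common vertex on each of the paths. -/
def sproutPivot : Option (Fin m) → Fin (n + 1)
  | none => i
  | some _ => 0

theorem sproutPath_pivot (c : Option (Fin m)) : sproutPath m i c (sproutPivot i c) = Sum.inl i := by
  cases c <;> rfl

theorem sproutIndex_path {c : Option (Fin m)} {t : Fin (n + 1)} (h : t ≠ sproutPivot i c) :
    sproutIndex (sproutPath m i c t) = c := by
  cases c with
  | none => rfl
  | some c =>
    induction t using Fin.cases with
    | zero => exact absurd rfl h
    | succ t => rfl

theorem sproutPath_injective (c : Option (Fin m)) : Function.Injective (sproutPath m i c) := by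
  cases c with
  | none => exact Sum.inl_injective
  | some c =>
    intro s t
    induction s using Fin.cases <;> induction t using Fin.cases <;> simp [sproutPath]

theorem exists_sproutPath_eq (v : Fin (n + 1) ⊕ Fin m × Fin n) :
    ∃ t, sproutPath m i (sproutIndex v) t = v := by
  rcases v with t | ⟨c, t⟩
  · exact ⟨t, rfl⟩
  · exact ⟨t.succ, rfl⟩

/-- The level of a vertex: below, at or above the common vertex. -/
def sproutLevel (π : Pattern (n + 1)) : Fin (n + 1) ⊕ Fin m × Fin n → ℕ
  | Sum.inl t => cmpLevel (π i) (π t)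
  | Sum.inr x => cmpLevel (π 0) (π x.2.succ)

theorem sproutLevel_path (π : Pattern (n + 1)) (c : Option (Fin m)) (t : Fin (n + 1)) :
    sproutLevel i π (sproutPath m i c t) = cmpLevel (π (sproutPivot i c)) (π t) := by
  cases c with
  | none => rfl
  | some c =>
    induction t using Fin.cases with
    | zero =>
      have h1 : cmpLevel (π i) (π i) = 1 := by simp
      have h2 : cmpLevel (π 0) (π 0) = 1 := by simp
      exact h1.trans h2.symm
    | succ t => rfl

theorem lext_sprout_eq_prod (π : Pattern (n + 1)) :
    lext (pathRel (sproutPath m i) π) univ =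
      ∏ s ∈ range 3, lext (pathRel (sproutPath m i) π) {v | sproutLevel i π v = s} := by
  apply lext_eq_prod_levels
  · intro v
    obtain ⟨t, ht⟩ := exists_sproutPath_eq i v
    rw [← ht, sproutLevel_path]
    exact cmpLevel_lt_three _ _
  · rintro _ _ ⟨c, s, t, hst, rfl, rfl⟩
    rw [sproutLevel_path, sproutLevel_path]
    exact cmpLevel_mono _ hst.le
  · intro u v h
    have hz : sproutLevel i π (Sum.inl i : Fin (n + 1) ⊕ Fin m × Fin n) = 1 := by
      simp [sproutLevel]
    -- The shared vertex lies on every path, so it is directly comparable with every other vertex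
    -- and links the lower level to the upper one.
    have below : ∀ u : Fin (n + 1) ⊕ Fin m × Fin n, sproutLevel i π u = 0 →
        pathRel (sproutPath m i) π u (Sum.inl i) := by
      intro u hu
      obtain ⟨t, ht⟩ := exists_sproutPath_eq i u
      rw [← ht, sproutLevel_path, cmpLevel_eq_zero] at hu
      exact ⟨_, _, _, hu, ht, sproutPath_pivot i _⟩
    have above : ∀ u : Fin (n + 1) ⊕ Fin m × Fin n, sproutLevel i π u = 2 →
        pathRel (sproutPath m i) π (Sum.inl i) u := by
      intro u hu
      obtain ⟨t, ht⟩ := exists_sproutPath_eq i u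
      rw [← ht, sproutLevel_path, cmpLevel_eq_two] at hu
      exact ⟨_, _, _, hu, sproutPath_pivot i _, ht⟩
    have at_pivot : ∀ u : Fin (n + 1) ⊕ Fin m × Fin n, sproutLevel i π u = 1 → u = Sum.inl i := by
      intro u hu
      obtain ⟨t, ht⟩ := exists_sproutPath_eq i u
      rw [← ht, sproutLevel_path, cmpLevel_eq_one, π.injective.eq_iff] at hu
      rw [← ht, hu, sproutPath_pivot]
    have hv : sproutLevel i π v < 3 := by
      obtain ⟨t, ht⟩ := exists_sproutPath_eq i v
      rw [← ht, sproutLevel_path]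
      exact cmpLevel_lt_three _ _
    obtain h' | h' | h' : (sproutLevel i π u = 0 ∧ sproutLevel i π v = 1) ∨
        (sproutLevel i π u = 0 ∧ sproutLevel i π v = 2) ∨
        (sproutLevel i π u = 1 ∧ sproutLevel i π v = 2) := by omega
    · rw [at_pivot v h'.2]
      exact .single (below u h'.1)
    · exact .tail (.single (below u h'.1)) (above v h'.2)
    · rw [at_pivot u h'.1]
      exact .single (above v h'.2)

theorem sprout_fiber (π : Pattern (n + 1)) {s : ℕ} (hs : s ≠ 1) (c : Option (Fin m)) :
    ({v ∈ ({v | sproutLevel i π v = s} : Finset (Fin (n + 1) ⊕ Fin m × Fin n)) |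
      sproutIndex v = c}) =
      ({t | cmpLevel (π (sproutPivot i c)) (π t) = s} : Finset _).image (sproutPath m i c) := by
  ext v
  simp only [mem_filter, mem_univ, true_and, mem_image]
  constructor
  · rintro ⟨h, rfl⟩
    obtain ⟨t, ht⟩ := exists_sproutPath_eq i v
    refine ⟨t, ?_, ht⟩
    rw [← sproutLevel_path, ht, h]
  · rintro ⟨t, h, rfl⟩
    refine ⟨by rw [sproutLevel_path, h], sproutIndex_path i ?_⟩
    rintro rfl
    rw [(cmpLevel_eq_one _).2 rfl] at h
    exact hs h.symm

theorem lext_sprout_fiber (π : Pattern (n + 1)) {s : ℕ} (hs : s ≠ 1) (c : Option (Fin m)) :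
    lext (pathRel (sproutPath m i) π)
      (({t | cmpLevel (π (sproutPivot i c)) (π t) = s} : Finset _).image (sproutPath m i c)) =
      1 := by
  rw [lext_image (fun t t' => π t < π t') _ _ _ (sproutPath_injective i c).injOn]
  · exact lext_chain _ (fun t => π t) _ (fun _ _ _ _ h => π.injective (Fin.ext h))
      fun _ _ _ _ => Iff.rfl
  · intro t ht t' ht'
    refine ⟨fun h => ⟨c, t, t', h, rfl, rfl⟩, ?_⟩
    rintro ⟨c', u, u', hlt, hu, hu'⟩
    -- Away from level `1`, that is, off the shared vertex, each vertex lies on one path only; hence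
    -- a relation inside the fiber can only come from path `c`.
    have hne : ∀ t : Fin (n + 1), cmpLevel (π (sproutPivot i c)) (π t) = s →
        ∀ u c', sproutPath m i c' u = sproutPath m i c t → c' = c := by
      intro t ht u c' hu
      have h1 : cmpLevel (π (sproutPivot i c')) (π u) = s := by
        rw [← sproutLevel_path, hu, sproutLevel_path, ht]
      have h2 : ∀ c : Option (Fin m), ∀ t, cmpLevel (π (sproutPivot i c)) (π t) = s →
          t ≠ sproutPivot i c := by
        rintro c t ht rfl
        rw [(cmpLevel_eq_one _).2 rfl] at ht
        exact hs ht.symm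
      rw [← sproutIndex_path i (h2 _ _ h1), hu, sproutIndex_path i (h2 _ _ ht)]
    simp only [mem_filter, mem_univ, true_and] at ht ht'
    obtain rfl := hne t ht u c' hu
    rw [← sproutPath_injective i c' hu, ← sproutPath_injective i c' hu']
    exact hlt

theorem lext_sprout_level (π : Pattern (n + 1)) {s : ℕ} (hs : s ≠ 1) :
    (lext (pathRel (sproutPath m i) π) {v | sproutLevel i π v = s} : ℚ) =
      (#{t | cmpLevel (π i) (π t) = s} + m * #{t | cmpLevel (π 0) (π t) = s}).factorial /
      ((#{t | cmpLevel (π i) (π t) = s}).factorial *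
        (#{t | cmpLevel (π 0) (π t) = s}).factorial ^ m) := by
  have hsome : ∀ c : Fin m, #{t | cmpLevel (π (sproutPivot i (some c))) (π t) = s} =
      #{t | cmpLevel (π 0) (π t) = s} := fun _ => rfl
  have hnone : #{t | cmpLevel (π (sproutPivot i (none : Option (Fin m)))) (π t) = s} =
      #{t | cmpLevel (π i) (π t) = s} := rfl
  have hcard : #({v | sproutLevel i π v = s} : Finset (Fin (n + 1) ⊕ Fin m × Fin n)) =
      #{t | cmpLevel (π i) (π t) = s} + m * #{t | cmpLevel (π 0) (π t) = s} := by
    rw [card_eq_sum_card_fiberwise (f := sproutIndex) (t := univ) (fun _ _ => mem_univ _)]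
    simp only [sprout_fiber i π hs, card_image_of_injective _ (sproutPath_injective i _)]
    rw [Fintype.sum_option]
    simp only [hsome, hnone, sum_const, card_univ, Fintype.card_fin, smul_eq_mul]
  have := lext_div_factorial_eq_prod (pathRel (sproutPath m i) π)
    ({v | sproutLevel i π v = s}) sproutIndex (by
      rintro _ hu _ hv ⟨c, t, t', _, rfl, rfl⟩
      simp only [mem_filter, mem_univ, true_and, sproutLevel_path] at hu hv
      have h2 : ∀ t, cmpLevel (π (sproutPivot i c)) (π t) = s → t ≠ sproutPivot i c := by
        rintro t ht rfl
        rw [(cmpLevel_eq_one _).2 rfl] at ht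
        exact hs ht.symm
      rw [sproutIndex_path i (h2 _ hu), sproutIndex_path i (h2 _ hv)])
  rw [hcard] at this
  simp only [sprout_fiber i π hs, card_image_of_injective _ (sproutPath_injective i _),
    lext_sprout_fiber i π hs] at this
  rw [Fintype.prod_option] at this
  rw [div_eq_iff (by positivity)] at this
  rw [this]
  simp only [hsome, hnone, prod_const, card_univ, Fintype.card_fin, Nat.cast_one, div_pow, one_pow]
  field_simp

theorem lext_sprout_pivot (π : Pattern (n + 1)) :
    lext (pathRel (sproutPath m i) π) {v | sproutLevel i π v = 1} = 1 := by
  have : ({v | sproutLevel i π v = 1} : Finset (Fin (n + 1) ⊕ Fin m × Fin n)) = {Sum.inl i} := by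
    ext v
    simp only [mem_filter, mem_univ, true_and, mem_singleton]
    constructor
    · intro hu
      obtain ⟨t, ht⟩ := exists_sproutPath_eq i v
      rw [← ht, sproutLevel_path, cmpLevel_eq_one, π.injective.eq_iff] at hu
      rw [← ht, hu, sproutPath_pivot]
    · rintro rfl
      simp [sproutLevel]
  rw [this]
  refine lext_chain _ (fun _ => 0) _ (by simp) ?_
  simp only [mem_singleton, lt_irrefl, iff_false]
  rintro u rfl v rfl ⟨c, t, t', hlt, h1, h2⟩
  rw [sproutPath_injective i c (h1.trans h2.symm)] at hlt
  exact lt_irrefl _ hlt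

/-- The number of extensions is a multinomial coefficient for the labels below the shared vertex
times one for those above it. Denominators are cleared to stay in `ℕ`. -/
theorem lext_sprout (π : Pattern (n + 1)) :
    lext (pathRel (sproutPath m i) π) univ * ((π i : ℕ).factorial * (n - π i : ℕ).factorial *
      ((π 0 : ℕ).factorial * (n - π 0 : ℕ).factorial) ^ m) =
      (π i + m * π 0 : ℕ).factorial * (n - π i + m * (n - π 0) : ℕ).factorial := by
  have h0 := lext_sprout_level (m := m) i π (s := 0) (by norm_num)
  have h2 := lext_sprout_level (m := m) i π (s := 2) (by norm_num)
  simp only [card_cmpLevel_zero, card_cmpLevel_two, Nat.add_sub_cancel] at h0 h2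
  have h := lext_sprout_eq_prod (m := m) i π
  rw [prod_range_succ, prod_range_succ, prod_range_one, lext_sprout_pivot, mul_one] at h
  rw [← Nat.cast_inj (R := ℚ), h]
  push_cast [h0, h2, mul_pow]
  field_simp

theorem sprout_invariance {π π' : Pattern (n + 1)} (h : SuperStrongEquiv π π') (m : ℕ) :
    lext (pathRel (sproutPath m i) π) univ = lext (pathRel (sproutPath m i) π') univ := by
  refine h.lext_eq (sproutPath m i)
    (Sum.elim (Fin.cases none fun t => some (Sum.inl t.castSucc))
      fun x => some (sproutPath m i (some x.1) x.2.castSucc))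
    (Sum.elim (fun t => t) fun x => i + 1 + x.2) ?_ ?_
  · rintro u (v | ⟨c, v⟩) h
    · induction v using Fin.cases with
      | zero => simp at h
      | succ v =>
        simp at h
        subst h
        simp
    · simp only [Sum.elim_inr, Option.some.injEq] at h
      subst h
      obtain ⟨v, hv⟩ := v
      cases v with
      | zero =>
        have : sproutPath m i (some c) (Fin.castSucc ⟨0, hv⟩) = Sum.inl i := rfl
        rw [this]
        simp
      | succ v =>
        have : sproutPath m i (some c) (Fin.castSucc ⟨v + 1, hv⟩) =
          Sum.inr (c, ⟨v, by omega⟩) := rfl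
        rw [this]
        simp
  · rintro (_ | c) t
    · rfl
    · rfl

end sprout

-- What the sprouts determine: the first letter up to complement, then each letter up to reflection.

theorem SuperStrongEquiv.head_eq_or {n : ℕ} {π π' : Pattern (n + 1)} (h : SuperStrongEquiv π π') :
    π' 0 = π 0 ∨ π' 0 = π.complement 0 := by
  have key : ∀ π : Pattern (n + 1), lext (pathRel (sproutPath 1 0) π) univ =
      (π 0 : ℕ).centralBinom * (n - π 0 : ℕ).centralBinom := by
    intro π
    have h1 := lext_sprout (m := 1) 0 π
    have ha := Nat.add_choose_mul_factorial_mul_factorial (π 0 : ℕ) (π 0 : ℕ)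
    have hb := Nat.add_choose_mul_factorial_mul_factorial (n - π 0 : ℕ) (n - π 0 : ℕ)
    rw [← two_mul, ← Nat.centralBinom_eq_two_mul_choose] at ha hb
    rw [one_mul, one_mul, ← two_mul, ← two_mul, ← ha, ← hb, pow_one] at h1
    have hpos : 0 < (π 0 : ℕ).factorial * (n - π 0 : ℕ).factorial *
      ((π 0 : ℕ).factorial * (n - π 0 : ℕ).factorial) := by positivity
    refine Nat.eq_of_mul_eq_mul_right hpos (h1.trans ?_)
    ring
  have e := sprout_invariance 0 h 1
  rw [key, key] at e
  have := (π 0).isLt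
  have := (π' 0).isLt
  rcases eq_or_eq_of_centralBinom_mul_eq (by omega) e.symm with h1 | h1
  · exact Or.inl (Fin.ext h1)
  · refine Or.inr (Fin.ext ?_)
    rw [h1, Pattern.complement, Equiv.trans_apply, Fin.revPerm_apply, Fin.val_rev]
    omega

theorem SuperStrongEquiv.eq_or_of_head_eq {n : ℕ} {π π' : Pattern (n + 1)}
    (h : SuperStrongEquiv π π') (h0 : π' 0 = π 0) (i : Fin (n + 1)) :
    π' i = π i ∨ (2 * (π 0 : ℕ) = n ∧ π' i = (π i).rev) := by
  have b0 := (π 0).isLt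
  have b1 := (π i).isLt
  have b2 := (π' i).isLt
  have := eq_or_eq_of_factorial_eq (n := n) (a := π 0) (b := n - π 0) (x := π i) (y := n - π i)
    (x' := π' i) (y' := n - π' i) (by omega) (by omega) (by omega) (by
      intro m
      have h1 := lext_sprout (m := m) i π
      have h2 := lext_sprout (m := m) i π'
      rw [← sprout_invariance i h m, h0] at h2
      rw [← h1, ← h2]
      ring)
  rcases this with h1 | ⟨h1, h2⟩
  · exact Or.inl (Fin.ext h1)
  · refine Or.inr ⟨by omega, Fin.ext ?_⟩
    rw [h2, Fin.val_rev]
    omega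

/-- Positivity is needed to cancel the unknown numbers of extensions of a tuft in
`prod_centralBinom_tuft_eq`. -/
theorem lext_pos {V : Type*} (r : V → V → Prop) (val : V → ℕ) (h : ∀ u v, r u v → val u < val v) :
    ∀ A : Finset V, 0 < lext r A := by
  classical
  intro A
  induction A using Finset.strongInduction with
  | H A ih =>
    rcases A.eq_empty_or_nonempty with rfl | hA
    · simp
    · obtain ⟨a, ha, hmin⟩ := exists_min_image A val hA
      rw [lext_eq_sum r hA]
      exact sum_pos' (fun _ _ => Nat.zero_le _) ⟨a, mem_filter.2 ⟨ha, fun b hb hr =>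
        (h _ _ hr).not_ge (hmin b hb)⟩, ih _ (erase_ssubset ha)⟩

theorem fin_val_one_of_pos {n : ℕ} (hn : 0 < n) : ((1 : Fin (n + 1)) : ℕ) = 1 := by
  rw [Fin.val_one', Nat.mod_eq_of_lt (by omega)]

-- Brooms: bundles of paths with two common vertices.

/-- The level of a letter with respect to two pivots: below both, at the smaller one, between them,
at the larger one, above both. -/
def pivotLevel {k : ℕ} (z z' w : Fin k) : ℕ := cmpLevel z w + cmpLevel z' w

/-- The vertices covered by `(p + 1) * (q + 1)` paths, indexed by pairs, which all share their first
two vertices and of which those with equal first index share the vertices up to position `j`.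
A vertex on several paths is represented with zero indices. -/
abbrev BroomVertex {n : ℕ} (p q : ℕ) (j : Fin (n + 1)) : Type :=
  {x : Fin (p + 1) × Fin (q + 1) × Fin (n + 1) //
    ((x.2.2 : ℕ) < 2 → x.1 = 0) ∧ (x.2.2 ≤ j → x.2.1 = 0)}

/-- The paths of the broom. -/
def broomPath {n : ℕ} (p q : ℕ) (j : Fin (n + 1)) (c : Fin (p + 1) × Fin (q + 1))
    (t : Fin (n + 1)) : BroomVertex p q j :=
  ⟨(if (t : ℕ) < 2 then 0 else c.1, if t ≤ j then 0 else c.2, t),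
    fun h => if_pos h, fun h => if_pos h⟩

section broom

variable {n p q : ℕ} {j : Fin (n + 1)}

theorem broomPath_self (v : BroomVertex p q j) :
    broomPath p q j (v.1.1, v.1.2.1) v.1.2.2 = v := by
  obtain ⟨⟨α, β, t⟩, h1, h2⟩ := v
  apply Subtype.ext
  simp only [broomPath, Prod.mk.injEq, and_true] at h1 h2 ⊢
  exact ⟨by split_ifs with h; exacts [(h1 h).symm, rfl],
    by split_ifs with h; exacts [(h2 h).symm, rfl]⟩

theorem broomPath_shared (hj : 2 ≤ (j : ℕ)) {t : Fin (n + 1)} (ht : (t : ℕ) < 2)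
    (c c' : Fin (p + 1) × Fin (q + 1)) : broomPath p q j c t = broomPath p q j c' t := by
  have : t ≤ j := Fin.le_def.2 (by omega)
  simp [broomPath, ht, this]

theorem lt_of_pathRel_broomPath {π : Pattern (n + 1)} {u v : BroomVertex p q j}
    (h : pathRel (broomPath p q j) π u v) : π u.1.2.2 < π v.1.2.2 := by
  obtain ⟨c, s, t, hst, rfl, rfl⟩ := h
  exact hst

/-- The vertex at position `z < 2` is on all paths, so vertices on different sides of it are
comparable through it, even when no path contains both. -/
theorem broom_transGen (hj : 2 ≤ (j : ℕ)) (π : Pattern (n + 1)) {z : Fin (n + 1)}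
    (hz : (z : ℕ) < 2) {u v : BroomVertex p q j}
    (h : cmpLevel (π z) (π u.1.2.2) < cmpLevel (π z) (π v.1.2.2)) :
    Relation.TransGen (pathRel (broomPath p q j) π) u v := by
  obtain ⟨h1, h2, h3⟩ := exists_pivot_of_cmpLevel_lt _ h
  have hu := broomPath_self u
  have hv := broomPath_self v
  set c := (u.1.1, u.1.2.1)
  set c' := (v.1.1, v.1.2.1)
  rcases h1.eq_or_lt with h1 | h1
  · have h1 := π.injective h1
    rw [h1, broomPath_shared hj hz c c'] at hu
    exact .single ⟨c', _, _, h1 ▸ h3, hu, hv⟩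
  · have r1 : pathRel (broomPath p q j) π u (broomPath p q j c' z) :=
      ⟨c, _, _, h1, hu, broomPath_shared hj hz c c'⟩
    rcases h2.eq_or_lt with h2 | h2
    · rw [π.injective h2, hv] at r1
      exact .single r1
    · exact .tail (.single r1) ⟨c', _, _, h2, rfl, hv⟩

theorem lext_broom_eq_prod (hj : 2 ≤ (j : ℕ)) (π : Pattern (n + 1)) {z z' : Fin (n + 1)}
    (hz : (z : ℕ) < 2) (hz' : (z' : ℕ) < 2) :
    lext (pathRel (broomPath p q j) π) univ =
      ∏ s ∈ range 5, lext (pathRel (broomPath p q j) π)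
        {v | pivotLevel (π z) (π z') (π v.1.2.2) = s} := by
  refine lext_eq_prod_levels _
    (fun v : BroomVertex p q j => pivotLevel (π z) (π z') (π v.1.2.2)) 5 ?_ ?_ ?_
  · intro v
    have h1 := cmpLevel_lt_three (π z) (π v.1.2.2)
    have h2 := cmpLevel_lt_three (π z') (π v.1.2.2)
    simp only [pivotLevel]
    omega
  · intro u v h
    have h := (lt_of_pathRel_broomPath h).le
    exact Nat.add_le_add (cmpLevel_mono _ h) (cmpLevel_mono _ h)
  · intro u v h
    by_cases h1 : cmpLevel (π z) (π u.1.2.2) < cmpLevel (π z) (π v.1.2.2)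
    · exact broom_transGen hj π hz h1
    · refine broom_transGen hj π hz' (z := z') ?_
      simp only [pivotLevel] at h
      omega

theorem pos_lt_two_of_pivotLevel_odd {π : Pattern (n + 1)} {z z' t : Fin (n + 1)}
    (hz : (z : ℕ) < 2) (hz' : (z' : ℕ) < 2) (h : Odd (pivotLevel (π z) (π z') (π t))) :
    (t : ℕ) < 2 := by
  have h1 := cmpLevel_lt_three (π z) (π t)
  have h2 := cmpLevel_lt_three (π z') (π t)
  obtain ⟨r, hr⟩ := h
  simp only [pivotLevel] at hr
  obtain h | h : cmpLevel (π z) (π t) = 1 ∨ cmpLevel (π z') (π t) = 1 := by omega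
  · rw [cmpLevel_eq_one, π.injective.eq_iff] at h
    rwa [h]
  · rw [cmpLevel_eq_one, π.injective.eq_iff] at h
    rwa [h]

theorem lext_broom_odd_level (hj : 2 ≤ (j : ℕ)) (π : Pattern (n + 1)) {z z' : Fin (n + 1)}
    (hz : (z : ℕ) < 2) (hz' : (z' : ℕ) < 2) {s : ℕ} (hs : Odd s) :
    lext (pathRel (broomPath p q j) π) {v | pivotLevel (π z) (π z') (π v.1.2.2) = s} = 1 := by
  have hlt : ∀ v ∈ ({v | pivotLevel (π z) (π z') (π v.1.2.2) = s} :
      Finset (BroomVertex p q j)), (v.1.2.2 : ℕ) < 2 := by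
    intro v hv
    refine pos_lt_two_of_pivotLevel_odd hz hz' (π := π) ?_
    rw [(mem_filter.1 hv).2]
    exact hs
  refine lext_chain _ (fun v => (π v.1.2.2 : ℕ)) _ ?_ ?_
  · intro u hu v hv huv
    have h := π.injective (Fin.ext huv)
    rw [← broomPath_self u, ← broomPath_self v, ← h, broomPath_shared hj (hlt u hu)]
  · intro u hu v hv
    refine ⟨fun h => lt_of_pathRel_broomPath h, fun h => ?_⟩
    refine ⟨0, _, _, h, ?_, ?_⟩
    · rw [broomPath_shared hj (hlt u hu) _ (u.1.1, u.1.2.1), broomPath_self]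
    · rw [broomPath_shared hj (hlt v hv) _ (v.1.1, v.1.2.1), broomPath_self]

/-- The part of the broom with a fixed first index, at level `s`. -/
def tuft (q : ℕ) (j : Fin (n + 1)) (π : Pattern (n + 1)) (z z' : Fin (n + 1)) (s : ℕ) :
    Finset (Fin (q + 1) × Fin (n + 1)) :=
  {x | pivotLevel (π z) (π z') (π x.2) = s ∧ (x.2 ≤ j → x.1 = 0)}

/-- The order constraints within the part of the broom with a fixed first index. -/
def tuftRel (j : Fin (n + 1)) (π : Pattern (n + 1)) (x y : Fin (q + 1) × Fin (n + 1)) : Prop :=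
  π x.2 < π y.2 ∧ ∃ b, (if x.2 ≤ j then 0 else b) = x.1 ∧ (if y.2 ≤ j then 0 else b) = y.1

/-- A pivot contributes `1` when compared with itself and `0` or `2` when compared with the other
pivot, so its level is odd. -/
theorem two_le_pos_of_pivotLevel_even {π : Pattern (n + 1)} {t : Fin (n + 1)} (hn : 0 < n)
    (h : Even (pivotLevel (π 0) (π 1) (π t))) : 2 ≤ (t : ℕ) := by
  by_contra hlt
  have h01 : (1 : Fin (n + 1)) ≠ 0 := by
    intro h
    have := congrArg Fin.val h
    rw [fin_val_one_of_pos hn] at this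
    simp at this
  have hodd : ∀ z w : Fin (n + 1), w ≠ z → Even (cmpLevel z w) := by
    intro z w hne
    have h1 := cmpLevel_lt_three z w
    have h2 : cmpLevel z w ≠ 1 := by rwa [Ne, cmpLevel_eq_one]
    rw [Nat.even_iff]
    omega
  have hone : ∀ z : Fin (n + 1), ¬ Even (cmpLevel z z) := by
    intro z
    rw [(cmpLevel_eq_one z).2 rfl]
    decide
  have ht : t = 0 ∨ t = 1 := by
    rcases Nat.lt_or_ge (t : ℕ) 1 with h | h
    · exact Or.inl (Fin.ext (by simpa using h))
    · refine Or.inr (Fin.ext ?_)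
      rw [fin_val_one_of_pos hn]
      omega
  rcases ht with rfl | rfl
  · rw [pivotLevel, Nat.even_add] at h
    exact hone _ (h.2 (hodd _ _ fun h => h01 (π.injective h).symm))
  · rw [pivotLevel, Nat.even_add] at h
    exact hone _ (h.1 (hodd _ _ fun h => h01 (π.injective h)))

theorem broom_fiber (hn : 0 < n) (π : Pattern (n + 1)) {s : ℕ} (hs : Even s) (c : Fin (p + 1)) :
    ({v ∈ ({v | pivotLevel (π 0) (π 1) (π v.1.2.2) = s} : Finset (BroomVertex p q j)) |
      v.1.1 = c}) = (tuft q j π 0 1 s).image fun x => broomPath p q j (c, x.1) x.2 := by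
  ext v
  simp only [mem_filter, mem_univ, true_and, mem_image, tuft]
  constructor
  · rintro ⟨h, rfl⟩
    exact ⟨v.1.2, ⟨h, v.2.2⟩, broomPath_self v⟩
  · rintro ⟨x, ⟨h1, h2⟩, rfl⟩
    have := two_le_pos_of_pivotLevel_even hn (h1 ▸ hs)
    exact ⟨h1, if_neg (by omega)⟩

theorem broomPath_injOn_tuft (π : Pattern (n + 1)) (s : ℕ) (c : Fin (p + 1)) :
    Set.InjOn (fun x : Fin (q + 1) × Fin (n + 1) => broomPath p q j (c, x.1) x.2)
      (tuft q j π 0 1 s) := by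
  rintro ⟨b, x⟩ hx ⟨b', y⟩ hy h
  simp only [tuft, coe_filter, mem_univ, true_and, Set.mem_ofPred_eq] at hx hy
  simp only [broomPath, Subtype.mk.injEq, Prod.mk.injEq] at h
  obtain ⟨-, h, rfl⟩ := h
  refine Prod.ext ?_ rfl
  split_ifs at h with hxj
  · exact (hx.2 hxj).trans (hy.2 hxj).symm
  · exact h

theorem lext_broom_fiber (hn : 0 < n) (π : Pattern (n + 1)) {s : ℕ} (hs : Even s)
    (c : Fin (p + 1)) :
    lext (pathRel (broomPath p q j) π)
      ((tuft q j π 0 1 s).image fun x => broomPath p q j (c, x.1) x.2) =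
      lext (tuftRel j π) (tuft q j π 0 1 s) := by
  refine lext_image _ _ _ _ (broomPath_injOn_tuft π s c) ?_
  intro x hx y hy
  simp only [tuft, mem_filter, mem_univ, true_and] at hx hy
  have hx2 := two_le_pos_of_pivotLevel_even hn (hx.1 ▸ hs)
  have hy2 := two_le_pos_of_pivotLevel_even hn (hy.1 ▸ hs)
  have ex : (if x.2 ≤ j then 0 else x.1) = x.1 := by
    split_ifs with h; exacts [(hx.2 h).symm, rfl]
  have ey : (if y.2 ≤ j then 0 else y.1) = y.1 := by
    split_ifs with h; exacts [(hy.2 h).symm, rfl]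
  constructor
  · rintro ⟨h, b, hb, hb'⟩
    refine ⟨(c, b), x.2, y.2, h, ?_, ?_⟩
    · simp only [broomPath, hb, ex]
    · simp only [broomPath, hb', ey]
  · rintro ⟨c', t, t', h, ht, ht'⟩
    simp only [broomPath, Subtype.mk.injEq, Prod.mk.injEq, ex, ey] at ht ht'
    obtain ⟨-, h1, rfl⟩ := ht
    obtain ⟨-, h2, rfl⟩ := ht'
    exact ⟨h, c'.2, h1, h2⟩

/-- An even level contains no shared pivot, so it consists of `p + 1` mutually unrelated copies of
the tuft. The number of extensions of the tuft itself stays unevaluated. -/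
theorem lext_broom_even_level (hn : 0 < n) (π : Pattern (n + 1)) {s : ℕ} (hs : Even s) :
    lext (pathRel (broomPath p q j) π) {v | pivotLevel (π 0) (π 1) (π v.1.2.2) = s} *
      (#(tuft q j π 0 1 s)).factorial ^ (p + 1) =
      ((p + 1) * #(tuft q j π 0 1 s)).factorial *
        lext (tuftRel j π) (tuft q j π 0 1 s) ^ (p + 1) := by
  have hcard : #({v | pivotLevel (π 0) (π 1) (π v.1.2.2) = s} : Finset (BroomVertex p q j)) =
      (p + 1) * #(tuft q j π 0 1 s) := by
    rw [card_eq_sum_card_fiberwise (f := fun v => v.1.1) (t := univ) (fun _ _ => mem_univ _)]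
    simp only [broom_fiber hn π hs, card_image_of_injOn (broomPath_injOn_tuft π s _)]
    simp
  have := lext_div_factorial_eq_prod (pathRel (broomPath p q j) π)
    ({v | pivotLevel (π 0) (π 1) (π v.1.2.2) = s}) (fun v => v.1.1) (by
      rintro _ hu _ hv ⟨c, t, t', _, rfl, rfl⟩
      simp only [mem_filter, mem_univ, true_and, broomPath] at hu hv ⊢
      have h1 := two_le_pos_of_pivotLevel_even hn (hu ▸ hs)
      have h2 := two_le_pos_of_pivotLevel_even hn (hv ▸ hs)
      rw [if_neg (by omega), if_neg (by omega)])
  rw [hcard] at this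
  simp only [broom_fiber hn π hs, card_image_of_injOn (broomPath_injOn_tuft π s _),
    lext_broom_fiber hn π hs, prod_const, card_univ, Fintype.card_fin, div_pow] at this
  rw [div_eq_div_iff (by positivity) (by positivity)] at this
  rw [mul_comm (Nat.factorial _)]
  exact_mod_cast this

theorem broom_invariance {π π' : Pattern (n + 1)} (h : SuperStrongEquiv π π') (p q : ℕ)
    (j : Fin (n + 1)) : lext (pathRel (broomPath p q j) π) univ =
      lext (pathRel (broomPath p q j) π') univ := by
  refine h.lext_eq (broomPath p q j)
    -- The coordinates of `v` select one path through it. Zeroing the indices at shared positions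
    -- makes the parent independent of that choice.
    (fun v => Fin.cases none (fun t => some (broomPath p q j (v.1.1, v.1.2.1) t.castSucc)) v.1.2.2)
    (fun v => v.1.2.2) ?_ ?_
  · rintro u ⟨⟨α, β, t⟩, hv⟩ h
    induction t using Fin.cases with
    | zero => simp at h
    | succ t =>
      simp only [Fin.cases_succ, Option.some.injEq] at h
      subst h
      simp [broomPath]
  · intro c t
    simp only [broomPath, Fin.cases_succ, Option.some.injEq, Subtype.mk.injEq, Prod.mk.injEq,
      and_true]
    constructor
    · split_ifs with h1 h2
      · rfl
      · simp at h1 h2; omega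
      · rfl
    · split_ifs with h1 h2
      · rfl
      · exact absurd ((Fin.castSucc_lt_succ (i := t)).le.trans h2) h1
      · rfl

/-- The sizes of the even levels of the broom are constrained by super-strong equivalence. -/
theorem prod_centralBinom_tuft_eq {π π' : Pattern (n + 1)} (h : SuperStrongEquiv π π')
    (hj : 2 ≤ (j : ℕ)) (q : ℕ) :
    (#(tuft q j π 0 1 0)).centralBinom * (#(tuft q j π 0 1 2)).centralBinom *
      (#(tuft q j π 0 1 4)).centralBinom =
    (#(tuft q j π' 0 1 0)).centralBinom * (#(tuft q j π' 0 1 2)).centralBinom *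
      (#(tuft q j π' 0 1 4)).centralBinom := by
  have hn : 0 < n := by have := j.isLt; omega
  have hz : ((0 : Fin (n + 1)) : ℕ) < 2 := by simp
  have hz' : ((1 : Fin (n + 1)) : ℕ) < 2 := by
    rw [fin_val_one_of_pos hn]; omega
  have hprod : ∀ (p : ℕ) (π : Pattern (n + 1)), lext (pathRel (broomPath p q j) π) univ =
      lext (pathRel (broomPath p q j) π) {v | pivotLevel (π 0) (π 1) (π v.1.2.2) = 0} *
      lext (pathRel (broomPath p q j) π) {v | pivotLevel (π 0) (π 1) (π v.1.2.2) = 2} *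
      lext (pathRel (broomPath p q j) π) {v | pivotLevel (π 0) (π 1) (π v.1.2.2) = 4} := by
    intro p π
    rw [lext_broom_eq_prod hj π hz hz']
    simp only [prod_range_succ, prod_range_zero, one_mul]
    rw [lext_broom_odd_level hj π hz hz' (s := 1) (by decide),
      lext_broom_odd_level hj π hz hz' (s := 3) (by decide)]
    simp only [mul_one]
  have single : ∀ (π : Pattern (n + 1)) (s : ℕ), Even s →
      lext (pathRel (broomPath 0 q j) π) {v | pivotLevel (π 0) (π 1) (π v.1.2.2) = s} =
        lext (tuftRel j π) (tuft q j π 0 1 s) := by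
    intro π s hs
    have : _ * _ ^ 1 = (1 * _).factorial * _ ^ 1 :=
      lext_broom_even_level (p := 0) (q := q) (j := j) hn π hs
    rw [pow_one, pow_one, one_mul, mul_comm] at this
    exact Nat.eq_of_mul_eq_mul_left (Nat.factorial_pos _) this
  have double : ∀ (π : Pattern (n + 1)) (s : ℕ), Even s →
      lext (pathRel (broomPath 1 q j) π) {v | pivotLevel (π 0) (π 1) (π v.1.2.2) = s} =
        (#(tuft q j π 0 1 s)).centralBinom * lext (tuftRel j π) (tuft q j π 0 1 s) ^ 2 := by
    intro π s hs
    have : _ * _ ^ 2 = (2 * _).factorial * _ ^ 2 :=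
      lext_broom_even_level (p := 1) (q := q) (j := j) hn π hs
    have hc := Nat.add_choose_mul_factorial_mul_factorial
      #(tuft q j π 0 1 s) #(tuft q j π 0 1 s)
    rw [← two_mul, ← Nat.centralBinom_eq_two_mul_choose] at hc
    rw [← hc] at this
    refine Nat.eq_of_mul_eq_mul_right (pow_pos (Nat.factorial_pos #(tuft q j π 0 1 s)) 2)
      (this.trans ?_)
    ring
  have hE : ∀ (π : Pattern (n + 1)) (s : ℕ), 0 < lext (tuftRel j π) (tuft q j π 0 1 s) :=
    fun π s => lext_pos _ (fun x => (π x.2 : ℕ)) (fun x y hxy => hxy.1) _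
  -- The unevaluated extension counts enter linearly for `p = 0` and squared for `p = 1`; dividing
  -- by the square of the first identity leaves only central binomial coefficients.
  have e0 := broom_invariance h 0 q j
  have e1 := broom_invariance h 1 q j
  rw [hprod, hprod, single π 0 (by decide), single π 2 (by decide), single π 4 (by decide),
    single π' 0 (by decide), single π' 2 (by decide), single π' 4 (by decide)] at e0
  rw [hprod, hprod, double π 0 (by decide), double π 2 (by decide), double π 4 (by decide),
    double π' 0 (by decide), double π' 2 (by decide), double π' 4 (by decide)] at e1
  have hpos := pow_pos (Nat.mul_pos (Nat.mul_pos (hE π 0) (hE π 2)) (hE π 4)) 2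
  refine Nat.eq_of_mul_eq_mul_right hpos ?_
  calc _ = _ := by ring
    _ = _ := e1
    _ = _ := by rw [e0]; ring

/-- A position up to `j` occurs once in the tuft, a later one `q + 1` times. The `q` missing copies
are moved to the left to avoid subtraction. -/
theorem card_tuft (q : ℕ) (j : Fin (n + 1)) (π : Pattern (n + 1)) (z z' : Fin (n + 1)) (s : ℕ) :
    #(tuft q j π z z' s) + q * #{x | x ≤ j ∧ pivotLevel (π z) (π z') (π x) = s} =
      (q + 1) * #{w | pivotLevel (π z) (π z') w = s} := by
  have h1 : #{w | pivotLevel (π z) (π z') w = s} = #{x | pivotLevel (π z) (π z') (π x) = s} :=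
    (card_equiv π (by simp)).symm
  have h2 : ∀ x : Fin (n + 1), #{y ∈ tuft q j π z z' s | y.2 = x} =
      if pivotLevel (π z) (π z') (π x) = s then (if x ≤ j then 1 else q + 1) else 0 := by
    intro x
    split_ifs with hx hxj
    · rw [card_eq_one]
      refine ⟨(0, x), ?_⟩
      ext ⟨b, y⟩
      simp only [tuft, mem_filter, mem_univ, true_and, mem_singleton, Prod.mk.injEq]
      constructor
      · rintro ⟨⟨h1, h2⟩, rfl⟩; exact ⟨h2 hxj, rfl⟩
      · rintro ⟨rfl, rfl⟩; exact ⟨⟨hx, fun _ => rfl⟩, rfl⟩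
    · have : ({y ∈ tuft q j π z z' s | y.2 = x} : Finset _) =
          univ.image fun b : Fin (q + 1) => (b, x) := by
        ext ⟨b, y⟩
        simp only [tuft, mem_filter, mem_univ, true_and, mem_image, Prod.mk.injEq,
          exists_eq_left]
        constructor
        · rintro ⟨_, rfl⟩; rfl
        · rintro rfl; exact ⟨⟨hx, fun h => absurd h hxj⟩, rfl⟩
      rw [this, card_image_of_injective _ fun b b' hb => (Prod.mk.inj hb).1]
      simp
    · rw [card_eq_zero, filter_eq_empty_iff]
      rintro y hy rfl
      exact hx (mem_filter.1 hy).2.1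
  rw [h1, card_eq_sum_card_fiberwise (f := Prod.snd) (t := univ) (fun _ _ => mem_univ _),
    card_filter, card_filter, mul_sum, mul_sum, ← sum_add_distrib]
  refine sum_congr rfl fun x _ => ?_
  rw [h2]
  by_cases hx : pivotLevel (π z) (π z') (π x) = s <;> by_cases hxj : x ≤ j <;>
    simp [hx, hxj, add_comm]

end broom

-- Excluding a first difference, and the conclusion.

/-- The two pairs have equal sums, so equal products would force `N = N'` or `N = M'`. The former
fails because they differ by `q`; the latter makes `q` divide `a - D`, which lies strictly between
`0` and `q`. -/
theorem centralBinom_mul_ne_of_weights {q a D c d N M N' M' : ℕ} (hD : D < a) (hq : a < q)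
    (h1 : N + q * (c + 1) = (q + 1) * a) (h2 : M + q * d = (q + 1) * D)
    (h1' : N' + q * c = (q + 1) * a) (h2' : M' + q * (d + 1) = (q + 1) * D) :
    N.centralBinom * M.centralBinom ≠ N'.centralBinom * M'.centralBinom := by
  rw [mul_add, mul_one] at h1 h2'
  intro h
  rcases eq_or_eq_of_centralBinom_mul_eq (by omega) h with rfl | rfl
  · omega
  · obtain ⟨e, rfl⟩ := Nat.exists_eq_add_of_lt hD
    have h3 : q * c = q * d + q * (e + 1) + (e + 1) := by nlinarith
    have hdvd : q ∣ e + 1 :=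
      (Nat.dvd_add_right (Dvd.intro (d + (e + 1)) (by ring))).1 ⟨c, h3.symm⟩
    have := Nat.le_of_dvd (by omega) hdvd
    omega

theorem card_filter_le_and {n : ℕ} (j : Fin n) (Q : Fin n → Prop) [DecidablePred Q] :
    #{x | x ≤ j ∧ Q x} = #{x | x < j ∧ Q x} + if Q j then 1 else 0 := by
  have hsplit : univ.filter (fun x => x ≤ j ∧ Q x) =
      univ.filter (fun x => x < j ∧ Q x) ∪ univ.filter (fun x => x = j ∧ Q x) := by
    rw [← filter_or]
    refine filter_congr fun x _ => ?_
    rw [le_iff_lt_or_eq, or_and_right]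
  rw [hsplit, card_union_of_disjoint (disjoint_filter.2 fun x _ h h' => h.1.ne h'.1)]
  congr 1
  split_ifs with h
  · rw [card_eq_one]
    exact ⟨j, by ext x; simp only [mem_filter, mem_univ, true_and, mem_singleton]
                 exact ⟨fun hx => hx.1, fun hx => ⟨hx, hx ▸ h⟩⟩⟩
  · rw [card_eq_zero, filter_eq_empty_iff]
    rintro x - ⟨rfl, hx⟩
    exact h hx

/-- If the first letter is the middle one and the second letter is small, then the first position
at which two equivalent patterns differ cannot carry a large letter of the first pattern. -/
theorem SuperStrongEquiv.not_first_difference {n : ℕ} {π π' : Pattern (n + 1)}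
    (h : SuperStrongEquiv π π') (hmid : 2 * (π 0 : ℕ) = n) (h0 : π' 0 = π 0) (h1 : π' 1 = π 1)
    (h10 : π 1 < π 0) {j : Fin (n + 1)} (hj : 2 ≤ (j : ℕ)) (hlt : ∀ x < j, π' x = π x)
    (hrev : π' j = (π j).rev) (hbig : π 0 < π j) : False := by
  set L := pivotLevel (π 0) (π 1) with hL
  have hsmall : (π j).rev < π 0 := by
    rw [Fin.lt_def, Fin.val_rev]
    have := Fin.lt_def.1 hbig
    omega
  have hne1 : (π j).rev ≠ π 1 := by
    rw [← hrev, ← h1]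
    intro he
    have := congrArg Fin.val (π'.injective he)
    rw [fin_val_one_of_pos (by have := j.isLt; omega)] at this
    omega
  have hLj : L (π j) = 4 := by
    rw [hL, pivotLevel, (cmpLevel_eq_two _).2 hbig, (cmpLevel_eq_two _).2 (h10.trans hbig)]
  have hLj' : L (π j).rev = 0 ∨ L (π j).rev = 2 := by
    rw [hL, pivotLevel, (cmpLevel_eq_zero _).2 hsmall]
    rcases lt_or_gt_of_ne hne1 with h | h
    · rw [(cmpLevel_eq_zero _).2 h]; exact Or.inl rfl
    · rw [(cmpLevel_eq_two _).2 h]; exact Or.inr rfl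
  have hD4 : #{w | L w = 4} = (π 0 : ℕ) := by
    have : ({w | L w = 4} : Finset (Fin (n + 1))) = Ioi (π 0) := by
      ext w
      simp only [mem_filter, mem_univ, true_and, mem_Ioi]
      constructor
      · intro hw
        have b1 := cmpLevel_lt_three (π 0) w
        have b2 := cmpLevel_lt_three (π 1) w
        rw [hL, pivotLevel] at hw
        exact (cmpLevel_eq_two _).1 (by omega)
      · intro hw
        rw [hL, pivotLevel, (cmpLevel_eq_two _).2 hw, (cmpLevel_eq_two _).2 (h10.trans hw)]
    rw [this, Fin.card_Ioi]
    omega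
  -- Levels `0` and `2` lie among the letters below `π 0` and omit `π 1`, whereas level `4` has
  -- exactly `π 0` letters because `π 0` is the middle one.
  have hD : ∀ r, r = 0 ∨ r = 2 → #{w | L w = r} < (π 0 : ℕ) := by
    intro r hr
    have hsub : ({w | L w = r} : Finset (Fin (n + 1))) ⊂ Iio (π 0) := by
      rw [ssubset_iff_of_subset]
      · refine ⟨π 1, mem_Iio.2 h10, ?_⟩
        simp only [mem_filter, mem_univ, true_and]
        rw [hL, pivotLevel, (cmpLevel_eq_zero _).2 h10, (cmpLevel_eq_one (π 1)).2 rfl]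
        omega
      · intro w hw
        simp only [mem_filter, mem_univ, true_and] at hw
        rw [mem_Iio]
        by_contra hle
        have hw1 : π 1 < w := h10.trans_le (not_lt.1 hle)
        have h3 : cmpLevel (π 0) w ≠ 0 := fun h3 => hle ((cmpLevel_eq_zero _).1 h3)
        rw [hL, pivotLevel, (cmpLevel_eq_two _).2 hw1] at hw
        omega
    have := card_lt_card hsub
    rwa [Fin.card_Iio] at this
  -- The choice `q = n + 1` exceeds `π 0`, as the divisibility argument requires.
  have key := prod_centralBinom_tuft_eq h hj (n + 1)
  have hc : ∀ s, #(tuft (n + 1) j π 0 1 s) + (n + 1) * (#{x | x < j ∧ L (π x) = s} +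
      if L (π j) = s then 1 else 0) = (n + 1 + 1) * #{w | L w = s} := by
    intro s
    rw [← card_filter_le_and j fun x => L (π x) = s]
    exact card_tuft (n + 1) j π 0 1 s
  have hc' : ∀ s, #(tuft (n + 1) j π' 0 1 s) + (n + 1) * (#{x | x < j ∧ L (π x) = s} +
      if L (π j).rev = s then 1 else 0) = (n + 1 + 1) * #{w | L w = s} := by
    intro s
    have h2 : #{x | x < j ∧ L (π x) = s} = #{x | x < j ∧ L (π' x) = s} := by
      congr 1
      refine filter_congr fun x _ => and_congr_right fun hx => ?_
      rw [hlt x hx]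
    have := card_tuft (n + 1) j π' 0 1 s
    rw [h0, h1] at this
    rw [h2, ← hrev, ← card_filter_le_and j fun x => L (π' x) = s]
    exact this
  have c4 := hc 4
  have c4' := hc' 4
  rw [hLj, if_pos rfl, hD4] at c4
  rw [if_neg (by omega), add_zero, hD4] at c4'
  have hq : (π 0 : ℕ) < n + 1 := (π 0).isLt
  -- The even level containing neither `π j` nor its reflection keeps its tuft size and cancels from
  -- `key`.
  have same : ∀ r, r ≠ 4 → L (π j).rev ≠ r →
      #(tuft (n + 1) j π 0 1 r) = #(tuft (n + 1) j π' 0 1 r) := by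
    intro r hr hr'
    have e := hc r
    have e' := hc' r
    rw [hLj, if_neg hr.symm] at e
    rw [if_neg hr'] at e'
    omega
  have contra : ∀ r, r = 0 ∨ r = 2 → L (π j).rev = r →
      (#(tuft (n + 1) j π 0 1 4)).centralBinom * (#(tuft (n + 1) j π 0 1 r)).centralBinom ≠
      (#(tuft (n + 1) j π' 0 1 4)).centralBinom * (#(tuft (n + 1) j π' 0 1 r)).centralBinom := by
    intro r hr hr'
    have e := hc r
    have e' := hc' r
    rw [hLj, if_neg (by omega), add_zero] at e
    rw [if_pos hr'] at e'
    exact centralBinom_mul_ne_of_weights (hD r hr) hq c4 e c4' e'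
  rcases hLj' with hr | hr
  · refine contra 0 (Or.inl rfl) hr ?_
    rw [same 2 (by omega) (by omega)] at key
    refine Nat.eq_of_mul_eq_mul_right
      (Nat.centralBinom_pos #(tuft (n + 1) j π' 0 1 2)) ?_
    linarith
  · refine contra 2 (Or.inr rfl) hr ?_
    rw [same 0 (by omega) (by omega)] at key
    refine Nat.eq_of_mul_eq_mul_right
      (Nat.centralBinom_pos #(tuft (n + 1) j π' 0 1 0)) ?_
    linarith

/-- If `π j` is small, its reflection `π' j` is large, and the roles of the two patterns are
exchanged. -/
theorem SuperStrongEquiv.not_first_difference_of_lt {n : ℕ} {π π' : Pattern (n + 1)}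
    (h : SuperStrongEquiv π π') (hmid : 2 * (π 0 : ℕ) = n) (h0 : π' 0 = π 0) (h1 : π' 1 = π 1)
    (h10 : π 1 < π 0) {j : Fin (n + 1)} (hj : 2 ≤ (j : ℕ)) (hlt : ∀ x < j, π' x = π x)
    (hrev : π' j = (π j).rev) : False := by
  rcases lt_trichotomy (π j) (π 0) with hj0 | hj0 | hj0
  · refine h.symm.not_first_difference (by rw [h0, hmid]) h0.symm h1.symm (by rw [h0, h1]; exact h10)
      hj (fun x hx => (hlt x hx).symm) (by rw [hrev, Fin.rev_rev]) ?_
    rw [h0, hrev, Fin.lt_def, Fin.val_rev]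
    have := Fin.lt_def.1 hj0
    omega
  · rw [π.injective hj0] at hj
    simp at hj
  · exact h.not_first_difference hmid h0 h1 h10 hj hlt hrev hj0

theorem SuperStrongEquiv.eq_of_middle {n : ℕ} {π π' : Pattern (n + 1)}
    (h : SuperStrongEquiv π π') (hn : 0 < n) (hmid : 2 * (π 0 : ℕ) = n) (h0 : π' 0 = π 0)
    (h1 : π' 1 = π 1) : π' = π := by
  by_contra hne
  have hex : ∃ j, π' j ≠ π j := by
    by_contra! hall
    exact hne (Equiv.ext hall)
  obtain ⟨j, hj, hmin⟩ := WellFounded.has_min (wellFounded_lt (α := Fin (n + 1)))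
    {j | π' j ≠ π j} hex
  have hlt : ∀ x < j, π' x = π x := fun x hx => by_contra fun hx' => hmin x hx' hx
  have hrev : π' j = (π j).rev := ((h.eq_or_of_head_eq h0 j).resolve_left hj).2
  have hj2 : 2 ≤ (j : ℕ) := by
    by_contra hlt2
    rcases Nat.lt_or_ge (j : ℕ) 1 with h2 | h2
    · obtain rfl : j = 0 := Fin.ext (by simpa using h2)
      exact hj h0
    · obtain rfl : j = 1 := Fin.ext (by rw [fin_val_one_of_pos hn]; omega)
      exact hj h1
  have hcomp : ∀ (σ : Pattern (n + 1)) i, σ.complement i = (σ i).rev := fun _ _ => rfl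
  rcases lt_trichotomy (π 1) (π 0) with h10 | h10 | h10
  · exact h.not_first_difference_of_lt hmid h0 h1 h10 hj2 hlt hrev
  · have := congrArg Fin.val (π.injective h10)
    rw [fin_val_one_of_pos hn] at this
    simp at this
  -- Complementing both patterns preserves all the hypotheses and moves the second letter below the
  -- middle.
  · refine h.complement_left.complement_right.not_first_difference_of_lt ?_ ?_ ?_ ?_ hj2 ?_ ?_
    · rw [hcomp, Fin.val_rev]; omega
    · rw [hcomp, hcomp, h0]
    · rw [hcomp, hcomp, h1]
    · rw [hcomp, hcomp, Fin.rev_lt_rev]; exact h10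
    · intro x hx
      rw [hcomp, hcomp, hlt x hx]
    · rw [hcomp, hcomp, hrev]

theorem SuperStrongEquiv.eq_or_eq_complement_of_head_eq {n : ℕ} {π π' : Pattern (n + 1)}
    (h : SuperStrongEquiv π π') (h0 : π' 0 = π 0) : π' = π ∨ π' = π.complement := by
  by_cases hmid : 2 * (π 0 : ℕ) = n
  · rcases Nat.eq_zero_or_pos n with rfl | hn
    · exact Or.inl (Equiv.ext fun _ => Subsingleton.elim (α := Fin 1) _ _)
    rcases h.eq_or_of_head_eq h0 1 with h1 | ⟨-, h1⟩
    · exact Or.inl (h.eq_of_middle hn hmid h0 h1)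
    · right
      -- The middle letter is its own reflection, so complementing `π'` corrects the second letter
      -- without disturbing the first.
      have h0' : π'.complement 0 = π 0 := by
        change (π' 0).rev = π 0
        rw [h0]
        apply Fin.ext
        rw [Fin.val_rev]
        omega
      have h1' : π'.complement 1 = π 1 := by
        change (π' 1).rev = π 1
        rw [h1, Fin.rev_rev]
      rw [← h.complement_right.eq_of_middle hn hmid h0' h1', Pattern.complement_complement]
  · exact Or.inl (Equiv.ext fun i => (h.eq_or_of_head_eq h0 i).resolve_right fun h => hmid h.1)

theorem theorem1p8 (k : ℕ) (π π' : Pattern k) (h : SuperStrongEquiv π π') :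
    π' = π ∨ π' = π.complement := by
  cases k with
  | zero => exact Or.inl (Subsingleton.elim _ _)
  | succ n =>
    rcases h.head_eq_or with h0 | h0
    · exact h.eq_or_eq_complement_of_head_eq h0
    · rcases h.complement_left.eq_or_eq_complement_of_head_eq h0 with h1 | h1
      · exact Or.inr h1
      · exact Or.inl (by rw [h1, Pattern.complement_complement])
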